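/- Let $\kappa,\tau\in\mathbb R$ with $\kappa\neq 4\tau^2$, let $F(x,y)=1+\frac{\kappa}{4}(x^2+y^2)$, and let $\mathcal N_{\kappa,\tau}$ be the BCV-space, that is, the open set $\{(x,y,z)\in\mathbb R^3: F(x,y)>0\}$ with the Riemannian metric $$g_{\kappa,\tau}=\frac{dx^2+dy^2}{F^2}+\Big(dz+\tau\,\frac{y\,dx-x\,dy}{F}\Big)^2 .$$ Let $E_3=\partial/\partial z$ be the Hopf vector field, let $M^2(\kappa)$ be the set $\{(x,y)\in\mathbb R^2 : F(x,y)>0\}$ with the metric $(dx^2+dy^2)/F^2$, and let $\psi:\mathcal N_{\kappa,\tau}\to M^2(\kappa)$, $\psi(x,y,z)=(x,y)$, be the Hopf fibration. Let $\mathcal M$ be a connected smooth surface without boundary, smoothly immersed in $\mathcal N_{\kappa,\tau}$ by $\varphi$ and oriented by a smooth unit normal vector field $N$ along $\varphi$; give it the induced metric, and let $A$ be its shape operator ($AX=-\overline\nabla_X N$, with $\overline\nabla$ the Levi-Civita connection of $g_{\kappa,\tau}$) and $f=\operatorname{trace}A$ its mean curvature function. Suppose that $\mathcal M$ is biconservative,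 i.e. $$2A(\operatorname{grad} f)+f\operatorname{grad} f=2f\,\operatorname{Ricci}(N)^{\top}\quad\text{on }\mathcal M,$$ where $\operatorname{Ricci}(N)^{\top}$ is the tangential component of the Ricci curvature of $\mathcal N_{\kappa,\tau}$ in the direction $N$, and that $\mathcal M$ is not minimal, i.e. $f$ does not vanish identically. Then the following statements are equivalent: (a) $\mathcal M$ is a constant angle (helix) surface: the angle $\alpha\in[0,\pi]$ between $N$ and $E_3$, given by $\cos\alpha=g_{\kappa,\tau}(E_3,N)$, is constant on $\mathcal M$; (b) $\mathcal M$ has constant mean curvature: $f$ is constant on $\mathcal M$; (c) $\mathcal M$ is a Hopf tube over a curve of constant geodesic curvature: there is a smooth curve $\gamma:I\to M^2(\kappa)$ on an open interval $I$, parametrized by arc length and of constant geodesic curvature, such that the image $\varphi(\mathcal M)$ is a relatively open subset of $\psi^{-1}(\gamma(I))$. -/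

import Mathlib

open scoped Manifold ContDiff Matrix

noncomputable section

namespace BCV

/-! ### Riemannian metrics on open subsets of `ℝⁿ`, in the standard coordinates

A metric is given by its matrix of components `g x i j = g_x(∂_i, ∂_j)`. -/

section Coordinates

variable {n : ℕ}

/-- The scalar product `g_x(v, w)`. -/
def inner (g : (Fin n → ℝ) → Matrix (Fin n) (Fin n) ℝ) (x v w : Fin n → ℝ) : ℝ :=
  v ⬝ᵥ (g x *ᵥ w)

/-- The partial derivative `∂_i u (x)`. -/
def partialDeriv (i : Fin n) (u : (Fin n → ℝ) → ℝ) (x : Fin n → ℝ) : ℝ :=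
  fderiv ℝ u x (Pi.single i 1)

/-- The Christoffel symbol `Γ^k_{ij}` of the Levi-Civita connection of `g`. -/
def christoffel (g : (Fin n → ℝ) → Matrix (Fin n) (Fin n) ℝ) (k i j : Fin n)
    (x : Fin n → ℝ) : ℝ :=
  (1 / 2) * ∑ l, (g x)⁻¹ k l *
    (partialDeriv i (fun y => g y j l) x + partialDeriv j (fun y => g y i l) x
      - partialDeriv l (fun y => g y i j) x)

/-- The component `R^l_{ijk}` of the curvature: `R(∂_i, ∂_j) ∂_k = ∑ l, R^l_{ijk} ∂_l`, where
`R(X, Y) = ∇_X ∇_Y - ∇_Y ∇_X - ∇_{[X, Y]}`. -/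
def curvature (g : (Fin n → ℝ) → Matrix (Fin n) (Fin n) ℝ) (l i j k : Fin n)
    (x : Fin n → ℝ) : ℝ :=
  partialDeriv i (christoffel g l j k) x - partialDeriv j (christoffel g l i k) x
    + ∑ p, (christoffel g l i p x * christoffel g p j k x
      - christoffel g l j p x * christoffel g p i k x)

/-- The matrix of the Ricci tensor, `Ric(Y, Z) = trace (X ↦ R(X, Y) Z)`. -/
def ricci (g : (Fin n → ℝ) → Matrix (Fin n) (Fin n) ℝ) (x : Fin n → ℝ) :
    Matrix (Fin n) (Fin n) ℝ :=
  Matrix.of fun j k => ∑ i, curvature g i i j k x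

/-- For vectors `v`, `w` at `x`, the vector `∑ k, Γ^k_{ij}(x) v^i w^j ∂_k`. -/
def connectionTerm (g : (Fin n → ℝ) → Matrix (Fin n) (Fin n) ℝ) (x v w : Fin n → ℝ) :
    Fin n → ℝ :=
  fun k => ∑ i, ∑ j, christoffel g k i j x * v i * w j

end Coordinates

/-! ### BCV-spaces and the Hopf fibration -/

/-- The function `F = 1 + (κ/4)(x² + y²)`. -/
def F (κ x y : ℝ) : ℝ := 1 + κ / 4 * (x ^ 2 + y ^ 2)

/-- The open subset of `ℝ³` on which the BCV-metric lives. -/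
def space (κ : ℝ) : Set (Fin 3 → ℝ) := {q | 0 < F κ (q 0) (q 1)}

/-- The components of the 1-form `dz + τ (y dx - x dy) / F`. -/
def contactForm (κ τ : ℝ) (q : Fin 3 → ℝ) : Fin 3 → ℝ :=
  ![τ * q 1 / F κ (q 0) (q 1), -(τ * q 0 / F κ (q 0) (q 1)), 1]

/-- The BCV-metric `(dx² + dy²) / F² + (dz + τ (y dx - x dy) / F)²`. -/
def metric (κ τ : ℝ) (q : Fin 3 → ℝ) : Matrix (Fin 3) (Fin 3) ℝ :=
  Matrix.diagonal ![1 / F κ (q 0) (q 1) ^ 2, 1 / F κ (q 0) (q 1) ^ 2, 0]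
    + Matrix.vecMulVec (contactForm κ τ q) (contactForm κ τ q)

/-- The Hopf vector field `E₃ = ∂/∂z`. -/
def hopfField : Fin 3 → ℝ := ![0, 0, 1]

/-- The domain of the base surface `M²(κ)`, which is the image of the BCV-space under the Hopf
fibration. -/
def base (κ : ℝ) : Set (Fin 2 → ℝ) := {q | 0 < F κ (q 0) (q 1)}

/-- The metric `(dx² + dy²) / F²` of `M²(κ)`. -/
def baseMetric (κ : ℝ) (q : Fin 2 → ℝ) : Matrix (Fin 2) (Fin 2) ℝ :=
  Matrix.diagonal ![1 / F κ (q 0) (q 1) ^ 2, 1 / F κ (q 0) (q 1) ^ 2]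

/-- The Hopf fibration `ψ(x, y, z) = (x, y)`. -/
def hopfFibration (q : Fin 3 → ℝ) : Fin 2 → ℝ := ![q 0, q 1]

/-! ### Curves in the base -/

/-- `γ` restricted to the open interval `I` is a smooth curve in `M²(κ)` parametrized by arc
length. -/
structure IsUnitSpeedCurve (κ : ℝ) (I : Set ℝ) (γ : ℝ → Fin 2 → ℝ) : Prop where
  isOpen : IsOpen I
  ordConnected : I.OrdConnected
  smooth : ContDiffOn ℝ ∞ γ I
  mem_base : ∀ s ∈ I, γ s ∈ base κ
  unit_speed : ∀ s ∈ I, inner (baseMetric κ) (γ s) (deriv γ s) (deriv γ s) = 1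

/-- The geodesic curvature `h(∇_t t, n)` of a unit speed curve in `M²(κ)`. Here `t = γ'` and `n`
is the rotation of `t` by a positive right angle, which is the positively oriented unit normal
because the metric of `M²(κ)` is conformal to the Euclidean one. -/
def geodesicCurvature (κ : ℝ) (γ : ℝ → Fin 2 → ℝ) (s : ℝ) : ℝ :=
  inner (baseMetric κ) (γ s)
    (deriv (deriv γ) s + connectionTerm (baseMetric κ) (γ s) (deriv γ s) (deriv γ s))
    ![-(deriv γ s 1), deriv γ s 0]

/-- The Hopf tube over the curve `γ` on `I`: the preimage of the curve under the Hopf fibration. -/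
def hopfTube (κ : ℝ) (I : Set ℝ) (γ : ℝ → Fin 2 → ℝ) : Set (Fin 3 → ℝ) :=
  {q ∈ space κ | hopfFibration q ∈ γ '' I}

/-! ### Oriented surfaces in BCV-spaces -/

/-- The bilinear form `(X, Y) ↦ B(S X, T Y)` on `V`, for a bilinear form on `ℝⁿ` with matrix `B`
and linear maps `S`, `T` from `V` to `ℝⁿ`. -/
def pullbackForm {n : ℕ} {V : Type*} [AddCommGroup V] [Module ℝ V] [TopologicalSpace V]
    [IsTopologicalAddGroup V] [ContinuousSMul ℝ V] (B : Matrix (Fin n) (Fin n) ℝ)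
    (S T : V →L[ℝ] (Fin n → ℝ)) : V →L[ℝ] V →L[ℝ] ℝ :=
  ∑ i, ∑ j, B i j • ((ContinuousLinearMap.proj (R := ℝ) i ∘L S).smulRight
    (ContinuousLinearMap.proj (R := ℝ) j ∘L T))

theorem pullbackForm_apply {n : ℕ} {V : Type*} [AddCommGroup V] [Module ℝ V]
    [TopologicalSpace V] [IsTopologicalAddGroup V] [ContinuousSMul ℝ V]
    (B : Matrix (Fin n) (Fin n) ℝ) (S T : V →L[ℝ] (Fin n → ℝ)) (v w : V) :
    pullbackForm B S T v w = S v ⬝ᵥ (B *ᵥ T w) := by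
  simp only [pullbackForm, sum_apply, smul_apply,
    ContinuousLinearMap.smulRight_apply, ContinuousLinearMap.comp_apply,
    ContinuousLinearMap.proj_apply, smul_eq_mul, dotProduct, Matrix.mulVec, Finset.mul_sum]
  exact Finset.sum_congr rfl fun i _ => Finset.sum_congr rfl fun j _ => by ring

section Surface

variable {M : Type*} [TopologicalSpace M] [ChartedSpace (EuclideanSpace ℝ (Fin 2)) M]

/-- The differential at `p` of a map from the surface `M` to `ℝⁿ`. -/
def differential {n : ℕ} (φ : M → Fin n → ℝ) (p : M) : TangentSpace (𝓡 2) p →L[ℝ] (Fin n → ℝ) :=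
  mfderiv (𝓡 2) 𝓘(ℝ, Fin n → ℝ) φ p

/-- `φ` is a smooth immersion of the surface `M` into the BCV-space with parameters `κ`, `τ`, and
`N` is a smooth unit normal vector field along it (which orients the surface). -/
structure IsOrientedSurface (κ τ : ℝ) (φ N : M → Fin 3 → ℝ) : Prop where
  smooth : ContMDiff (𝓡 2) 𝓘(ℝ, Fin 3 → ℝ) ∞ φ
  mem_space : ∀ p, φ p ∈ space κ
  immersion : ∀ p, Function.Injective (differential φ p)
  smooth_normal : ContMDiff (𝓡 2) 𝓘(ℝ, Fin 3 → ℝ) ∞ N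
  normal_unit : ∀ p, inner (metric κ τ) (φ p) (N p) (N p) = 1
  normal_orthogonal : ∀ p (X : TangentSpace (𝓡 2) p),
    inner (metric κ τ) (φ p) (N p) (differential φ p X) = 0

/-- The covariant derivative `X ↦ ∇_X N` along `φ` of the vector field `N`, for the Levi-Civita
connection of the BCV-metric. -/
def covDeriv (κ τ : ℝ) (φ N : M → Fin 3 → ℝ) (p : M) :
    TangentSpace (𝓡 2) p →L[ℝ] (Fin 3 → ℝ) :=
  differential N p + ContinuousLinearMap.pi fun k =>
    ∑ i, ∑ j, (christoffel (metric κ τ) k i j (φ p) * N p j) •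
      (ContinuousLinearMap.proj (R := ℝ) i ∘L differential φ p)

theorem covDeriv_apply (κ τ : ℝ) (φ N : M → Fin 3 → ℝ) (p : M) (X : TangentSpace (𝓡 2) p) :
    covDeriv κ τ φ N p X = differential N p X +
      connectionTerm (metric κ τ) (φ p) (differential φ p X) (N p) := by
  ext k
  simp only [covDeriv, connectionTerm, add_apply, Pi.add_apply,
    ContinuousLinearMap.coe_pi', sum_apply, smul_apply,
    ContinuousLinearMap.comp_apply, ContinuousLinearMap.proj_apply, smul_eq_mul]
  congr 1
  exact Finset.sum_congr rfl fun i _ => Finset.sum_congr rfl fun j _ => by ring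

/-- The induced metric (first fundamental form) on `T_p M`. -/
def firstForm (κ τ : ℝ) (φ : M → Fin 3 → ℝ) (p : M) :
    TangentSpace (𝓡 2) p →L[ℝ] TangentSpace (𝓡 2) p →L[ℝ] ℝ :=
  pullbackForm (metric κ τ (φ p)) (differential φ p) (differential φ p)

/-- The second fundamental form `(X, Y) ↦ g(-∇_X N, dφ Y)`. -/
def secondForm (κ τ : ℝ) (φ N : M → Fin 3 → ℝ) (p : M) :
    TangentSpace (𝓡 2) p →L[ℝ] TangentSpace (𝓡 2) p →L[ℝ] ℝ :=
  pullbackForm (metric κ τ (φ p)) (-covDeriv κ τ φ N p) (differential φ p)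

/-- The musical isomorphism from covectors to vectors at `p`, for the induced metric: the inverse
of `X ↦ ⟨X, ·⟩`. -/
def sharp (κ τ : ℝ) (φ : M → Fin 3 → ℝ) (p : M) :
    (TangentSpace (𝓡 2) p →L[ℝ] ℝ) →L[ℝ] TangentSpace (𝓡 2) p :=
  (firstForm κ τ φ p).inverse

/-- The shape operator `A X = -(∇_X N)`. -/
def shapeOperator (κ τ : ℝ) (φ N : M → Fin 3 → ℝ) (p : M) :
    TangentSpace (𝓡 2) p →L[ℝ] TangentSpace (𝓡 2) p :=
  sharp κ τ φ p ∘L secondForm κ τ φ N p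

/-- The mean curvature function `f = trace A`. -/
def meanCurvature (κ τ : ℝ) (φ N : M → Fin 3 → ℝ) (p : M) : ℝ :=
  LinearMap.trace ℝ (TangentSpace (𝓡 2) p) (shapeOperator κ τ φ N p).toLinearMap

/-- The gradient, for the induced metric, of a function `u` on the surface. -/
def grad (κ τ : ℝ) (φ : M → Fin 3 → ℝ) (u : M → ℝ) (p : M) : TangentSpace (𝓡 2) p :=
  sharp κ τ φ p (mfderiv (𝓡 2) 𝓘(ℝ, ℝ) u p)

/-- The vector `Ric(N)ᵀ` of `T_p M`, characterized by `⟨Ric(N)ᵀ, X⟩ = Ric(N, dφ X)`. -/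
def ricciTangent (κ τ : ℝ) (φ N : M → Fin 3 → ℝ) (p : M) : TangentSpace (𝓡 2) p :=
  sharp κ τ φ p (∑ j, (N p ᵥ* ricci (metric κ τ) (φ p)) j •
    (ContinuousLinearMap.proj (R := ℝ) j ∘L differential φ p))

/-- The surface is biconservative: `2 A(grad f) + f grad f = 2 f Ric(N)ᵀ`. -/
def IsBiconservative (κ τ : ℝ) (φ N : M → Fin 3 → ℝ) : Prop :=
  ∀ p : M,
    (2 : ℝ) • shapeOperator κ τ φ N p (grad κ τ φ (meanCurvature κ τ φ N) p)
      + meanCurvature κ τ φ N p • grad κ τ φ (meanCurvature κ τ φ N) p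
    = (2 * meanCurvature κ τ φ N p) • ricciTangent κ τ φ N p

/-- The surface is minimal: its mean curvature vanishes identically. -/
def IsMinimal (κ τ : ℝ) (φ N : M → Fin 3 → ℝ) : Prop :=
  ∀ p : M, meanCurvature κ τ φ N p = 0

/-- The surface has constant mean curvature. -/
def IsCMC (κ τ : ℝ) (φ N : M → Fin 3 → ℝ) : Prop :=
  ∃ c : ℝ, ∀ p : M, meanCurvature κ τ φ N p = c

/-- The angle in `[0, π]` between the unit normal and the Hopf vector field. -/
def angle (κ τ : ℝ) (φ N : M → Fin 3 → ℝ) (p : M) : ℝ :=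
  Real.arccos (inner (metric κ τ) (φ p) hopfField (N p))

/-- The surface is a constant angle (helix) surface. -/
def IsConstantAngle (κ τ : ℝ) (φ N : M → Fin 3 → ℝ) : Prop :=
  ∃ α : ℝ, ∀ p : M, angle κ τ φ N p = α

/-- The immersed surface is a Hopf tube over the curve `γ` on `I`, in the local sense usual for
surfaces: its image is an open part of the full preimage of the curve. -/
def IsHopfTubeOver (κ : ℝ) (φ : M → Fin 3 → ℝ) (I : Set ℝ) (γ : ℝ → Fin 2 → ℝ) : Prop :=
  ∃ U : Set (Fin 3 → ℝ), IsOpen U ∧ Set.range φ = U ∩ hopfTube κ I γ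

end Surface

end BCV

end

/-!
The proof works in the orthonormal frame `E₁ = F∂ₓ - τy∂_z`, `E₂ = F∂_y + τx∂_z`, `E₃ = ∂_z`. Write
`ν = cos α` for the third frame component of the normal, `T` for the tangential part of `E₃`, so that
`|T|² = 1 - ν²`, and `W` for the quarter turn of `T` in the surface. In this frame
`Ricci(N)ᵀ = (4τ² - κ) ν T`, so the biconservative equation says that `2A(grad f) + f grad f` equals
`2(4τ² - κ) f ν T`. All quantities are studied in a parametrization of the surface by a planar open
set, where the Gauss–Codazzi equations become the symmetry of the second differential of the
immersion and of the normal.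

*Constant angle gives constant mean curvature.* If `ν = ±1` the surface is orthogonal to `E₃` and
minimal. Otherwise constancy of `ν` determines `A` in the orthonormal basis along `T`, `W`: the
diagonal entries are `0` and `f`, the others are `τ` (`exists_tangent_frame_shape`). If `ν = 0`, the
biconservative equation then reduces to `(3f² - 4τ²) grad f = 0`, so `f` is constant. If
`0 < ν² < 1`, the Codazzi equation gives `df(T) = -ν (f² + κ(1 - ν²) + 4τ²ν²)`
(`fderiv_curvature_tangent`), and together with the biconservative equation `f` is a root of a fixed
nonzero polynomial (`curvature_polynomial_of_angle_oblique`); a continuous function with finitely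
many possible values on a connected surface is constant.

*Constant mean curvature gives a Hopf tube.* For constant `f ≠ 0` and `κ ≠ 4τ²` the equation reads
`ν T = 0`, so that `ν²` takes only the values `0` and `1` and is constant; as `ν² = 1` would make the
surface minimal, `ν = 0`. The surface then lies over a plane curve, and along it the Euclidean curvature
`k = (f - (κ/2) n·p) / F` is constant, so that `n + k p` is constant and the plane curve is an arc of
a Euclidean circle or straight line (`exists_curve_equation`). Reparametrizing this conic by arc
length of the base gives a unit speed curve of constant geodesic curvature
(`exists_unitSpeed_baseCircle`). The surface is open in the tube because its normal variation fills
an open set and immediately leaves the tube (`exists_isOpen_range_eq`).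

*A Hopf tube has constant angle.* Where `ν ≠ 0` the projection to the base is open, but the image of a
smooth curve has dense complement; so `ν = 0`.
-/

open scoped Manifold ContDiff Matrix

noncomputable section

namespace BCV

/-! ### Christoffel symbols and Ricci tensor of the BCV-metric -/

section Gradient

variable {n : ℕ} {u w : (Fin n → ℝ) → ℝ} {d e : Fin n → ℝ} {q : Fin n → ℝ}

/-- `u` is differentiable at `q`, with partial derivatives `d i`. -/
def HasGrad (u : (Fin n → ℝ) → ℝ) (d q : Fin n → ℝ) : Prop :=
  HasFDerivAt u (∑ i, d i • ContinuousLinearMap.proj (R := ℝ) (φ := fun _ : Fin n => ℝ) i) q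

theorem HasGrad.partialDeriv_eq (h : HasGrad u d q) (i : Fin n) : partialDeriv i u q = d i := by
  rw [partialDeriv, HasFDerivAt.fderiv h]
  simp [Pi.single_apply]

theorem HasGrad.congr_grad (h : HasGrad u d q) (hd : d = e) : HasGrad u e q := hd ▸ h

theorem hasGrad_const (c : ℝ) : HasGrad (fun _ => c) (fun _ => 0) q := by
  simpa [HasGrad] using hasFDerivAt_const c q

theorem hasGrad_coord (i : Fin n) : HasGrad (fun q => q i) (Pi.single i 1) q := by
  have h := (ContinuousLinearMap.proj (R := ℝ) (φ := fun _ : Fin n => ℝ) i).hasFDerivAt (x := q)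
  refine h.congr_fderiv ?_
  simp [Pi.single_apply]

theorem HasGrad.add (hu : HasGrad u d q) (hw : HasGrad w e q) :
    HasGrad (fun q => u q + w q) (fun i => d i + e i) q := by
  refine (HasFDerivAt.add hu hw).congr_fderiv ?_
  simp [add_smul, Finset.sum_add_distrib]

theorem HasGrad.mul (hu : HasGrad u d q) (hw : HasGrad w e q) :
    HasGrad (fun q => u q * w q) (fun i => d i * w q + u q * e i) q := by
  refine (HasFDerivAt.mul hu hw).congr_fderiv ?_
  simp only [add_smul, Finset.sum_add_distrib, Finset.smul_sum, smul_smul]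
  rw [add_comm]
  congr 1
  exact Finset.sum_congr rfl fun i _ => by rw [mul_comm]

theorem HasGrad.const_mul (c : ℝ) (hu : HasGrad u d q) :
    HasGrad (fun q => c * u q) (fun i => c * d i) q :=
  ((hasGrad_const c).mul hu).congr_grad (by simp)

theorem HasGrad.inv (hu : HasGrad u d q) (h0 : u q ≠ 0) :
    HasGrad (fun q => (u q)⁻¹) (fun i => -d i / u q ^ 2) q := by
  refine ((hasDerivAt_inv h0).comp_hasFDerivAt q hu).congr_fderiv ?_
  simp only [Finset.smul_sum, smul_smul]
  exact Finset.sum_congr rfl fun i _ => by congr 1; field_simp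

end Gradient

section Ambient

variable (κ τ : ℝ)

/-- Rational functions of the shape of the Christoffel symbols of the BCV-metric. -/
def christoffelForm (b : Fin 5 → ℝ) (x y : ℝ) : ℝ :=
  b 0 + (b 1 * x + b 2 * y) * (F κ x y)⁻¹
    + (b 3 * (x * x + (-1) * (y * y)) + b 4 * (x * y)) * ((F κ x y)⁻¹ * (F κ x y)⁻¹)

/-- The partial derivatives of `christoffelForm`. -/
def christoffelFormGrad (b : Fin 5 → ℝ) (x y : ℝ) : Fin 3 → ℝ :=
  ![b 1 * (F κ x y)⁻¹ - (b 1 * x + b 2 * y) * (κ / 2 * x) * (F κ x y)⁻¹ ^ 2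
      + (2 * b 3 * x + b 4 * y) * (F κ x y)⁻¹ ^ 2
      - 2 * (b 3 * (x ^ 2 - y ^ 2) + b 4 * (x * y)) * (κ / 2 * x) * (F κ x y)⁻¹ ^ 3,
    b 2 * (F κ x y)⁻¹ - (b 1 * x + b 2 * y) * (κ / 2 * y) * (F κ x y)⁻¹ ^ 2
      + (-2 * b 3 * y + b 4 * x) * (F κ x y)⁻¹ ^ 2
      - 2 * (b 3 * (x ^ 2 - y ^ 2) + b 4 * (x * y)) * (κ / 2 * y) * (F κ x y)⁻¹ ^ 3,
    0]

variable {κ}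

theorem hasGrad_F (q : Fin 3 → ℝ) :
    HasGrad (fun q : Fin 3 → ℝ => F κ (q 0) (q 1)) ![κ / 2 * q 0, κ / 2 * q 1, 0] q := by
  have h := (hasGrad_const (q := q) 1).add (HasGrad.const_mul (κ / 4)
    (((hasGrad_coord 0).mul (hasGrad_coord 0)).add ((hasGrad_coord 1).mul (hasGrad_coord 1))))
  have h2 : (fun q : Fin 3 → ℝ => F κ (q 0) (q 1)) =
      fun q => 1 + κ / 4 * (q 0 * q 0 + q 1 * q 1) := by
    funext q; simp only [F]; ring
  rw [h2]
  refine h.congr_grad ?_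
  funext i
  fin_cases i <;> simp <;> ring

theorem hasGrad_christoffelForm (b : Fin 5 → ℝ) {q : Fin 3 → ℝ} (hq : F κ (q 0) (q 1) ≠ 0) :
    HasGrad (fun q : Fin 3 → ℝ => christoffelForm κ b (q 0) (q 1))
      (christoffelFormGrad κ b (q 0) (q 1)) q := by
  have hx : HasGrad (fun q : Fin 3 → ℝ => q 0) _ q := hasGrad_coord 0
  have hy : HasGrad (fun q : Fin 3 → ℝ => q 1) _ q := hasGrad_coord 1
  have hF := (hasGrad_F (κ := κ) q).inv hq
  have h := (((hasGrad_const (q := q) (b 0)).add (((hx.const_mul (b 1)).add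
    (hy.const_mul (b 2))).mul hF)).add
    (((((hx.mul hx).add ((hy.mul hy).const_mul (-1))).const_mul (b 3)).add
      ((hx.mul hy).const_mul (b 4))).mul (hF.mul hF)))
  refine h.congr_grad ?_
  funext i
  fin_cases i <;> simp [christoffelFormGrad] <;> field_simp <;> ring

variable (κ)

/-- The coefficients of the Christoffel symbol `Γ^k_{ij}` of the BCV-metric in
`christoffelForm`. -/
def christoffelCoeff (k i j : Fin 3) : Fin 5 → ℝ :=
  ![![![![0, -(κ / 2), 0, 0, 0], ![0, 0, τ ^ 2 - κ / 2, 0, 0], ![0, 0, 0, 0, 0]],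
      ![![0, 0, τ ^ 2 - κ / 2, 0, 0], ![0, κ / 2 - 2 * τ ^ 2, 0, 0, 0], ![τ, 0, 0, 0, 0]],
      ![![0, 0, 0, 0, 0], ![τ, 0, 0, 0, 0], ![0, 0, 0, 0, 0]]],
    ![![![0, 0, κ / 2 - 2 * τ ^ 2, 0, 0], ![0, τ ^ 2 - κ / 2, 0, 0, 0], ![-τ, 0, 0, 0, 0]],
      ![![0, τ ^ 2 - κ / 2, 0, 0, 0], ![0, 0, -(κ / 2), 0, 0], ![0, 0, 0, 0, 0]],
      ![![-τ, 0, 0, 0, 0], ![0, 0, 0, 0, 0], ![0, 0, 0, 0, 0]]],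
    ![![![0, 0, 0, 0, τ * (κ / 2 - 2 * τ ^ 2)], ![0, 0, 0, τ * (τ ^ 2 - κ / 4), 0],
        ![0, -τ ^ 2, 0, 0, 0]],
      ![![0, 0, 0, τ * (τ ^ 2 - κ / 4), 0], ![0, 0, 0, 0, -(τ * (κ / 2 - 2 * τ ^ 2))],
        ![0, 0, -τ ^ 2, 0, 0]],
      ![![0, -τ ^ 2, 0, 0, 0], ![0, 0, -τ ^ 2, 0, 0], ![0, 0, 0, 0, 0]]]] k i j

/-- The inverse of the matrix of the BCV-metric. -/
def metricInv (x y : ℝ) : Matrix (Fin 3) (Fin 3) ℝ :=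
  !![F κ x y ^ 2, 0, -(τ * y * F κ x y);
     0, F κ x y ^ 2, τ * x * F κ x y;
     -(τ * y * F κ x y), τ * x * F κ x y, 1 + τ ^ 2 * (x ^ 2 + y ^ 2)]

variable {κ}

theorem metric_inv {q : Fin 3 → ℝ} (hq : F κ (q 0) (q 1) ≠ 0) :
    (metric κ τ q)⁻¹ = metricInv κ τ (q 0) (q 1) := by
  apply Matrix.inv_eq_right_inv
  ext i j
  fin_cases i <;> fin_cases j <;>
    simp [metric, metricInv, contactForm, Matrix.mul_apply, Fin.sum_univ_three] <;>
    field_simp <;> ring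

variable (κ)

/-- The coefficients of the entries of the BCV-metric, as functions of the form
`(b₀ + b₁ x² + b₂ xy + b₃ y²) / F² + (b₄ x + b₅ y) / F + b₆`. -/
def metricCoeff (i j : Fin 3) : Fin 7 → ℝ :=
  ![![![1, 0, 0, τ ^ 2, 0, 0, 0], ![0, 0, -τ ^ 2, 0, 0, 0, 0], ![0, 0, 0, 0, 0, τ, 0]],
    ![![0, 0, -τ ^ 2, 0, 0, 0, 0], ![1, τ ^ 2, 0, 0, 0, 0, 0], ![0, 0, 0, 0, -τ, 0, 0]],
    ![![0, 0, 0, 0, 0, τ, 0], ![0, 0, 0, 0, -τ, 0, 0], ![0, 0, 0, 0, 0, 0, 1]]] i j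

/-- The partial derivatives of the rational function with coefficients `b` described at
`metricCoeff`. -/
def metricGrad (b : Fin 7 → ℝ) (x y : ℝ) : Fin 3 → ℝ :=
  ![(2 * b 1 * x + b 2 * y) * (F κ x y)⁻¹ ^ 2
      - 2 * (b 0 + b 1 * x ^ 2 + b 2 * x * y + b 3 * y ^ 2) * (κ / 2 * x) * (F κ x y)⁻¹ ^ 3
      + b 4 * (F κ x y)⁻¹ - (b 4 * x + b 5 * y) * (κ / 2 * x) * (F κ x y)⁻¹ ^ 2,
    (b 2 * x + 2 * b 3 * y) * (F κ x y)⁻¹ ^ 2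
      - 2 * (b 0 + b 1 * x ^ 2 + b 2 * x * y + b 3 * y ^ 2) * (κ / 2 * y) * (F κ x y)⁻¹ ^ 3
      + b 5 * (F κ x y)⁻¹ - (b 4 * x + b 5 * y) * (κ / 2 * y) * (F κ x y)⁻¹ ^ 2,
    0]

variable {κ}

theorem hasGrad_metric (i j : Fin 3) {q : Fin 3 → ℝ} (hq : F κ (q 0) (q 1) ≠ 0) :
    HasGrad (fun q => metric κ τ q i j) (metricGrad κ (metricCoeff τ i j) (q 0) (q 1)) q := by
  have hx : HasGrad (fun q : Fin 3 → ℝ => q 0) _ q := hasGrad_coord 0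
  have hy : HasGrad (fun q : Fin 3 → ℝ => q 1) _ q := hasGrad_coord 1
  have hF := (hasGrad_F (κ := κ) q).inv hq
  set b := metricCoeff τ i j with hb
  have h := (((((hasGrad_const (q := q) (b 0)).add ((hx.mul hx).const_mul (b 1))).add
    ((hx.mul hy).const_mul (b 2))).add ((hy.mul hy).const_mul (b 3))).mul (hF.mul hF)).add
    (((((hx.const_mul (b 4)).add (hy.const_mul (b 5))).mul hF)).add (hasGrad_const (b 6)))
  have hfun : (fun q => metric κ τ q i j) = fun q : Fin 3 → ℝ =>
      (b 0 + b 1 * (q 0 * q 0) + b 2 * (q 0 * q 1) + b 3 * (q 1 * q 1))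
        * ((F κ (q 0) (q 1))⁻¹ * (F κ (q 0) (q 1))⁻¹)
        + ((b 4 * q 0 + b 5 * q 1) * (F κ (q 0) (q 1))⁻¹ + b 6) := by
    funext q
    fin_cases i <;> fin_cases j <;>
      simp [hb, metric, metricCoeff, contactForm] <;> ring
  rw [hfun]
  refine h.congr_grad ?_
  funext l
  fin_cases l <;> simp [metricGrad] <;> field_simp <;> ring

theorem christoffel_metric (k i j : Fin 3) {q : Fin 3 → ℝ} (hq : F κ (q 0) (q 1) ≠ 0) :
    christoffel (metric κ τ) k i j q
      = christoffelForm κ (christoffelCoeff κ τ k i j) (q 0) (q 1) := by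
  simp only [christoffel, (hasGrad_metric τ _ _ hq).partialDeriv_eq, metric_inv τ hq,
    Fin.sum_univ_three]
  simp only [metricGrad, metricInv, christoffelForm]
  obtain ⟨G, hG⟩ : ∃ G, G = F κ (q 0) (q 1) := ⟨_, rfl⟩
  rw [← hG] at hq ⊢
  simp only [F] at hG
  fin_cases k <;> fin_cases i <;> fin_cases j <;>
    simp [metricCoeff, christoffelCoeff] <;> field_simp <;> subst hG <;> ring

theorem ricci_metric {q : Fin 3 → ℝ} (hq : F κ (q 0) (q 1) ≠ 0) :
    ricci (metric κ τ) q = (κ - 2 * τ ^ 2) • metric κ τ q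
      + (4 * τ ^ 2 - κ) • Matrix.vecMulVec (contactForm κ τ q) (contactForm κ τ q) := by
  have hev : ∀ k i j, christoffel (metric κ τ) k i j =ᶠ[nhds q]
      fun q => christoffelForm κ (christoffelCoeff κ τ k i j) (q 0) (q 1) := by
    intro k i j
    have hc : Continuous fun q : Fin 3 → ℝ => F κ (q 0) (q 1) := by unfold F; fun_prop
    filter_upwards [(isOpen_ne.preimage hc).mem_nhds hq] with q' hq'
    exact christoffel_metric τ k i j hq'
  have hpd : ∀ l k i j, partialDeriv l (christoffel (metric κ τ) k i j) q
      = christoffelFormGrad κ (christoffelCoeff κ τ k i j) (q 0) (q 1) l := by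
    intro l k i j
    rw [partialDeriv, (hev k i j).fderiv_eq]
    exact (hasGrad_christoffelForm _ hq).partialDeriv_eq l
  ext j k
  simp only [ricci, Matrix.of_apply, curvature, hpd, christoffel_metric τ _ _ _ hq,
    Fin.sum_univ_three, christoffelForm, christoffelFormGrad]
  obtain ⟨G, hG⟩ : ∃ G, G = F κ (q 0) (q 1) := ⟨_, rfl⟩
  simp only [metric, contactForm]
  rw [← hG] at hq ⊢
  simp only [F] at hG
  fin_cases j <;> fin_cases k <;>
    simp [christoffelCoeff] <;> field_simp <;> subst hG <;> ring

end Ambient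

/-! ### The orthonormal frame of a BCV-space -/

section Frame

variable (κ τ : ℝ)

/-- The components of a vector at `q` in the orthonormal frame `E₁ = F ∂x - τ y ∂z`,
`E₂ = F ∂y + τ x ∂z`, `E₃ = ∂z`. -/
def frameCoord (q : Fin 3 → ℝ) : (Fin 3 → ℝ) →L[ℝ] (Fin 3 → ℝ) :=
  ContinuousLinearMap.pi
    ![(F κ (q 0) (q 1))⁻¹ • ContinuousLinearMap.proj 0,
      (F κ (q 0) (q 1))⁻¹ • ContinuousLinearMap.proj 1,
      ContinuousLinearMap.proj 2 + (τ * (F κ (q 0) (q 1))⁻¹) •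
        (q 1 • ContinuousLinearMap.proj 0 - q 0 • ContinuousLinearMap.proj 1)]

@[simp] theorem frameCoord_zero (q v : Fin 3 → ℝ) :
    frameCoord κ τ q v 0 = (F κ (q 0) (q 1))⁻¹ * v 0 := by
  simp [frameCoord]

@[simp] theorem frameCoord_one (q v : Fin 3 → ℝ) :
    frameCoord κ τ q v 1 = (F κ (q 0) (q 1))⁻¹ * v 1 := by
  simp [frameCoord]

@[simp] theorem frameCoord_two (q v : Fin 3 → ℝ) :
    frameCoord κ τ q v 2 = v 2 + τ * (F κ (q 0) (q 1))⁻¹ * (q 1 * v 0 - q 0 * v 1) := by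
  simp [frameCoord]

theorem frameCoord_injective {q : Fin 3 → ℝ} (hq : F κ (q 0) (q 1) ≠ 0) :
    Function.Injective (frameCoord κ τ q) := by
  rw [injective_iff_map_eq_zero]
  intro v hv
  have h0 := congrFun hv 0
  have h1 := congrFun hv 1
  have h2 := congrFun hv 2
  simp only [frameCoord_zero, frameCoord_one, frameCoord_two, Pi.zero_apply, mul_eq_zero,
    inv_eq_zero, hq, false_or] at h0 h1 h2
  simp only [h0, h1, mul_zero, sub_zero, add_zero] at h2
  ext i
  fin_cases i <;> assumption

theorem inner_metric (q v w : Fin 3 → ℝ) :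
    inner (metric κ τ) q v w = frameCoord κ τ q v ⬝ᵥ frameCoord κ τ q w := by
  simp [inner, metric, contactForm, dotProduct, Fin.sum_univ_three, Matrix.mulVec]
  ring

theorem inner_hopfField (q v : Fin 3 → ℝ) :
    inner (metric κ τ) q hopfField v = frameCoord κ τ q v 2 := by
  simp [inner_metric, dotProduct, Fin.sum_univ_three, hopfField]

/-- The derivative of the frame components of a vector field with value `w` and derivative `dw`,
when the base point moves from `q` with velocity `v`. -/
def frameDeriv (q v w dw : Fin 3 → ℝ) : Fin 3 → ℝ :=
  let r := -((κ / 2 * (q 0 * v 0 + q 1 * v 1)) / F κ (q 0) (q 1) ^ 2)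
  ![r * w 0 + (F κ (q 0) (q 1))⁻¹ * dw 0, r * w 1 + (F κ (q 0) (q 1))⁻¹ * dw 1,
    dw 2 + (τ * r * (q 1 * w 0 - q 0 * w 1) + τ * (F κ (q 0) (q 1))⁻¹ *
      ((v 1 * w 0 + q 1 * dw 0) - (v 0 * w 1 + q 0 * dw 1)))]

/-- The connection form `g(∇E₂, E₁)` at a point over `(x, y)`, on a vector with frame components
`a`. -/
def rotationForm (x y : ℝ) (a : Fin 3 → ℝ) : ℝ := κ / 2 * (x * a 1 - y * a 0) + τ * a 2

/-- The covariant derivative in the frame: `a` are the frame components of the direction, `n` those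
of the vector field and `dn` their derivative in that direction. -/
def frameCov (x y : ℝ) (a n dn : Fin 3 → ℝ) : Fin 3 → ℝ :=
  ![dn 0 + rotationForm κ τ x y a * n 1 + τ * n 2 * a 1,
    dn 1 - rotationForm κ τ x y a * n 0 - τ * n 2 * a 0,
    dn 2 + τ * (a 0 * n 1 - a 1 * n 0)]

theorem frameCoord_covDeriv {q : Fin 3 → ℝ} (hq : F κ (q 0) (q 1) ≠ 0) (v w dw : Fin 3 → ℝ) :
    frameCoord κ τ q (dw + connectionTerm (metric κ τ) q v w)
      = frameCov κ τ (q 0) (q 1) (frameCoord κ τ q v) (frameCoord κ τ q w)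
          (frameDeriv κ τ q v w dw) := by
  have key : ∀ k, connectionTerm (metric κ τ) q v w k =
      ∑ i, ∑ j, christoffelForm κ (christoffelCoeff κ τ k i j) (q 0) (q 1) * v i * w j := by
    intro k
    simp only [connectionTerm, christoffel_metric τ _ _ _ hq]
  obtain ⟨G, hG⟩ : ∃ G, G = F κ (q 0) (q 1) := ⟨_, rfl⟩
  have hG' := hG
  simp only [F] at hG'
  ext i
  fin_cases i <;>
  · simp [key, frameCov, frameDeriv, christoffelForm, christoffelCoeff, rotationForm,
      Fin.sum_univ_three]
    rw [← hG] at hq ⊢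
    field_simp
    subst hG'
    ring

theorem vecMul_ricci {q : Fin 3 → ℝ} (hq : F κ (q 0) (q 1) ≠ 0) (v w : Fin 3 → ℝ) :
    (v ᵥ* ricci (metric κ τ) q) ⬝ᵥ w
      = (κ - 2 * τ ^ 2) * (frameCoord κ τ q v ⬝ᵥ frameCoord κ τ q w)
        + (4 * τ ^ 2 - κ) * (frameCoord κ τ q v 2 * frameCoord κ τ q w 2) := by
  rw [← inner_metric, ricci_metric τ hq, ← Matrix.dotProduct_mulVec, Matrix.add_mulVec,
    dotProduct_add, Matrix.smul_mulVec, Matrix.smul_mulVec, dotProduct_smul, dotProduct_smul]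
  simp only [inner, smul_eq_mul]
  congr 2
  simp [contactForm, dotProduct, Fin.sum_univ_three, Matrix.mulVec]
  ring

end Frame

/-! ### Linear algebra of a tangent plane in the frame -/

section TangentPlane

/-- The determinant of three vectors of `ℝ³`. -/
def tripleProduct (u v w : Fin 3 → ℝ) : ℝ :=
  u 0 * (v 1 * w 2 - v 2 * w 1) - u 1 * (v 0 * w 2 - v 2 * w 0) + u 2 * (v 0 * w 1 - v 1 * w 0)

variable {V : Type*} [AddCommGroup V] [Module ℝ V] {a : V →ₗ[ℝ] (Fin 3 → ℝ)} {n : Fin 3 → ℝ}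

/-- An injective linear map from a plane into `n^⊥` is onto `n^⊥`. -/
theorem exists_eq_of_dotProduct_eq_zero (hV : Module.finrank ℝ V = 2)
    (ha : Function.Injective a) (hn : n ⬝ᵥ n = 1) (hna : ∀ X, n ⬝ᵥ a X = 0) {b : Fin 3 → ℝ}
    (hb : n ⬝ᵥ b = 0) : ∃ X, a X = b := by
  let l : Module.Dual ℝ (Fin 3 → ℝ) := dotProductBilin ℝ ℝ n
  have hl : ∀ v, l v = n ⬝ᵥ v := fun v => rfl
  have hl0 : l ≠ 0 := by
    intro h
    have := hl n
    rw [h, hn] at this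
    simp at this
  have h1 := Module.Dual.finrank_ker_add_one_of_ne_zero hl0
  have h2 : a.range = l.ker := by
    apply Submodule.eq_of_le_of_finrank_eq
    · rintro _ ⟨X, rfl⟩
      exact hna X
    · rw [LinearMap.finrank_range_of_inj ha, hV]
      simp at h1
      omega
  have h3 : b ∈ a.range := by rw [h2]; exact hb
  exact h3

/-- The trace of the shape operator, in terms of the covariant derivative `c` of the normal: the
derivation of the area form induced by `-c` is multiplication by the trace. -/
theorem trace_mul_tripleProduct (hV : Module.finrank ℝ V = 2)
    (ha : Function.Injective a) (hn : n ⬝ᵥ n = 1) (hna : ∀ X, n ⬝ᵥ a X = 0)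
    {c : V →ₗ[ℝ] (Fin 3 → ℝ)} {A : V →ₗ[ℝ] V} (hA : ∀ X Y, a (A X) ⬝ᵥ a Y = -(c X ⬝ᵥ a Y))
    (X Y : V) : LinearMap.trace ℝ V A * tripleProduct (a X) (a Y) n
      = -tripleProduct (c X) (a Y) n - tripleProduct (a X) (c Y) n := by
  -- `A` and `-c` differ by multiples of `n`
  have hpar : ∀ X, ∃ t : ℝ, c X = t • n - a (A X) := by
    intro X
    set w := c X + a (A X) with hw
    obtain ⟨Z, hZ⟩ := exists_eq_of_dotProduct_eq_zero (b := w - (n ⬝ᵥ w) • n) hV ha hn hna (by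
      rw [dotProduct_sub, dotProduct_smul, hn]; simp)
    have h1 : w ⬝ᵥ a Z = 0 := by rw [hw, add_dotProduct, hA]; ring
    have h2 : a Z ⬝ᵥ a Z = 0 := by
      nth_rewrite 1 [hZ]
      rw [sub_dotProduct, h1, smul_dotProduct, hna]; simp
    rw [dotProduct_self_eq_zero, hZ, sub_eq_zero] at h2
    exact ⟨n ⬝ᵥ w, by rw [← h2, hw]; simp⟩
  obtain ⟨s, hs⟩ := hpar X
  obtain ⟨t, ht⟩ := hpar Y
  have : Module.Finite ℝ V := Module.finite_of_finrank_pos (by omega)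
  let b := Module.finBasisOfFinrankEq ℝ V hV
  have hrep : ∀ Z, a Z = b.repr Z 0 • a (b 0) + b.repr Z 1 • a (b 1) := by
    intro Z
    conv_lhs => rw [← b.sum_repr Z, Fin.sum_univ_two, map_add, map_smul, map_smul]
  have hX := hrep X
  have hY := hrep Y
  have hAX : a (A X) = b.repr X 0 • a (A (b 0)) + b.repr X 1 • a (A (b 1)) := by
    conv_lhs => rw [← b.sum_repr X, Fin.sum_univ_two, map_add, map_smul, map_smul, map_add,
      map_smul, map_smul]
  have hAY : a (A Y) = b.repr Y 0 • a (A (b 0)) + b.repr Y 1 • a (A (b 1)) := by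
    conv_lhs => rw [← b.sum_repr Y, Fin.sum_univ_two, map_add, map_smul, map_smul, map_add,
      map_smul, map_smul]
  rw [hrep (A (b 0)), hrep (A (b 1))] at hAX hAY
  have htr : LinearMap.trace ℝ V A = b.repr (A (b 0)) 0 + b.repr (A (b 1)) 1 := by
    rw [LinearMap.trace_eq_matrix_trace ℝ b, Matrix.trace_fin_two]
    simp [LinearMap.toMatrix_apply]
  rw [hs, ht, hAX, hAY, hX, hY, htr]
  simp only [tripleProduct, Pi.sub_apply, Pi.smul_apply, Pi.add_apply, smul_eq_mul]
  ring

end TangentPlane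

section Surface

variable {κ τ : ℝ} {M : Type*} [TopologicalSpace M] [ChartedSpace (EuclideanSpace ℝ (Fin 2)) M]
  {φ N : M → Fin 3 → ℝ}

theorem finrank_tangentSpace (p : M) : Module.finrank ℝ (TangentSpace (𝓡 2) p) = 2 :=
  finrank_euclideanSpace_fin (𝕜 := ℝ) (n := 2)

variable (κ τ φ) in
/-- The differential of the immersion, in frame components. -/
def frameDifferential (p : M) : TangentSpace (𝓡 2) p →L[ℝ] (Fin 3 → ℝ) :=
  frameCoord κ τ (φ p) ∘L differential φ p

theorem firstForm_apply (p : M) (X Y : TangentSpace (𝓡 2) p) :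
    firstForm κ τ φ p X Y = frameDifferential κ τ φ p X ⬝ᵥ frameDifferential κ τ φ p Y := by
  rw [firstForm, pullbackForm_apply]
  exact inner_metric κ τ (φ p) _ _

theorem secondForm_apply (hM : IsOrientedSurface κ τ φ N) (p : M) (X Y : TangentSpace (𝓡 2) p) :
    secondForm κ τ φ N p X Y = -(frameCov κ τ (φ p 0) (φ p 1) (frameDifferential κ τ φ p X)
      (frameCoord κ τ (φ p) (N p))
      (frameDeriv κ τ (φ p) (differential φ p X) (N p) (differential N p X))
        ⬝ᵥ frameDifferential κ τ φ p Y) := by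
  rw [secondForm, pullbackForm_apply]
  refine (inner_metric κ τ (φ p) _ _).trans ?_
  rw [neg_apply, map_neg, neg_dotProduct, covDeriv_apply,
    frameCoord_covDeriv κ τ (hM.mem_space p).ne']
  rfl

theorem frameDifferential_injective (hM : IsOrientedSurface κ τ φ N) (p : M) :
    Function.Injective (frameDifferential κ τ φ p) :=
  (frameCoord_injective κ τ (hM.mem_space p).ne').comp (hM.immersion p)

theorem firstForm_injective (hM : IsOrientedSurface κ τ φ N) (p : M)
    (Y : TangentSpace (𝓡 2) p) (hY : firstForm κ τ φ p Y = 0) : Y = 0 := by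
  have h1 : firstForm κ τ φ p Y Y = 0 := by rw [hY]; rfl
  rw [firstForm_apply, dotProduct_self_eq_zero] at h1
  exact (map_eq_zero_iff _ (frameDifferential_injective hM p)).mp h1

theorem firstForm_sharp (hM : IsOrientedSurface κ τ φ N) (p : M)
    (l : TangentSpace (𝓡 2) p →L[ℝ] ℝ) (X : TangentSpace (𝓡 2) p) :
    firstForm κ τ φ p (sharp κ τ φ p l) X = l X := by
  have hinv : (firstForm κ τ φ p).IsInvertible := by
    let g : EuclideanSpace ℝ (Fin 2) →L[ℝ] EuclideanSpace ℝ (Fin 2) →L[ℝ] ℝ := firstForm κ τ φ p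
    have hg : Function.Injective g :=
      (injective_iff_map_eq_zero g).mpr fun Y hY => firstForm_injective hM p Y hY
    have hfr : Module.finrank ℝ (EuclideanSpace ℝ (Fin 2)) =
        Module.finrank ℝ (EuclideanSpace ℝ (Fin 2) →L[ℝ] ℝ) := by
      rw [LinearEquiv.finrank_eq
        (LinearMap.toContinuousLinearMap (𝕜 := ℝ) (E := EuclideanSpace ℝ (Fin 2)) (F' := ℝ)).symm]
      exact (Subspace.dual_finrank_eq (K := ℝ) (V := EuclideanSpace ℝ (Fin 2))).symm
    let e := (LinearEquiv.ofInjectiveOfFinrankEq g.toLinearMap hg hfr).toContinuousLinearEquiv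
    exact ⟨e, by ext1 Y; rfl⟩
  have := hinv.self_apply_inverse l
  exact congrArg (fun l => l X) this

/-- The differential at `p` of a real function on the surface. -/
def realDifferential (u : M → ℝ) (p : M) : TangentSpace (𝓡 2) p →L[ℝ] ℝ :=
  mfderiv (𝓡 2) 𝓘(ℝ, ℝ) u p

variable (κ τ φ N) in
/-- The covariant derivative of the normal, in frame components. -/
def frameCovDeriv (p : M) : TangentSpace (𝓡 2) p →L[ℝ] (Fin 3 → ℝ) :=
  frameCoord κ τ (φ p) ∘L covDeriv κ τ φ N p

theorem frameCovDeriv_apply (hM : IsOrientedSurface κ τ φ N) (p : M) (X : TangentSpace (𝓡 2) p) :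
    frameCovDeriv κ τ φ N p X = frameCov κ τ (φ p 0) (φ p 1) (frameDifferential κ τ φ p X)
      (frameCoord κ τ (φ p) (N p))
      (frameDeriv κ τ (φ p) (differential φ p X) (N p) (differential N p X)) := by
  refine Eq.trans ?_ (frameCoord_covDeriv κ τ (hM.mem_space p).ne' _ _ _)
  exact congrArg (frameCoord κ τ (φ p)) (covDeriv_apply κ τ φ N p X)

theorem frameNormal_dotProduct_self (hM : IsOrientedSurface κ τ φ N) (p : M) :
    frameCoord κ τ (φ p) (N p) ⬝ᵥ frameCoord κ τ (φ p) (N p) = 1 := by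
  rw [← inner_metric, hM.normal_unit]

theorem frameNormal_dotProduct (hM : IsOrientedSurface κ τ φ N) (p : M)
    (X : TangentSpace (𝓡 2) p) :
    frameCoord κ τ (φ p) (N p) ⬝ᵥ frameDifferential κ τ φ p X = 0 := by
  rw [← hM.normal_orthogonal p X, inner_metric]
  rfl

theorem meanCurvature_mul_tripleProduct (hM : IsOrientedSurface κ τ φ N) (p : M)
    (X Y : TangentSpace (𝓡 2) p) :
    meanCurvature κ τ φ N p * tripleProduct (frameDifferential κ τ φ p X)
        (frameDifferential κ τ φ p Y) (frameCoord κ τ (φ p) (N p))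
      = -tripleProduct (frameCovDeriv κ τ φ N p X) (frameDifferential κ τ φ p Y)
          (frameCoord κ τ (φ p) (N p))
        - tripleProduct (frameDifferential κ τ φ p X) (frameCovDeriv κ τ φ N p Y)
          (frameCoord κ τ (φ p) (N p)) := by
  refine trace_mul_tripleProduct (a := (frameDifferential κ τ φ p).toLinearMap)
    (c := (frameCovDeriv κ τ φ N p).toLinearMap) (finrank_tangentSpace p)
    (frameDifferential_injective hM p) (frameNormal_dotProduct_self hM p)
    (frameNormal_dotProduct hM p) (fun X Y => ?_) X Y
  refine (firstForm_apply p _ _).symm.trans ((firstForm_sharp hM p _ _).trans ?_)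
  refine (secondForm_apply hM p X Y).trans ?_
  rw [← frameCovDeriv_apply hM]
  rfl

theorem IsBiconservative.exists_grad (hM : IsOrientedSurface κ τ φ N)
    (hb : IsBiconservative κ τ φ N) (p : M) :
    ∃ G : TangentSpace (𝓡 2) p, ∀ Y : TangentSpace (𝓡 2) p,
      frameDifferential κ τ φ p G ⬝ᵥ frameDifferential κ τ φ p Y
        = realDifferential (meanCurvature κ τ φ N) p Y ∧
      -2 * (frameCovDeriv κ τ φ N p G ⬝ᵥ frameDifferential κ τ φ p Y)
        + meanCurvature κ τ φ N p * realDifferential (meanCurvature κ τ φ N) p Y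
        = 2 * meanCurvature κ τ φ N p * ((4 * τ ^ 2 - κ) *
          (frameCoord κ τ (φ p) (N p) 2 * frameDifferential κ τ φ p Y 2)) := by
  refine ⟨grad κ τ φ (meanCurvature κ τ φ N) p, fun Y => ?_⟩
  have h1 := firstForm_sharp hM p (realDifferential (meanCurvature κ τ φ N) p) Y
  refine ⟨(firstForm_apply p _ _).symm.trans h1, ?_⟩
  have h2 := congrArg (fun Z => firstForm κ τ φ p Z Y) (hb p)
  simp only [map_add, map_smul, add_apply, smul_apply, smul_eq_mul] at h2
  have h3 : firstForm κ τ φ p (shapeOperator κ τ φ N p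
      (grad κ τ φ (meanCurvature κ τ φ N) p)) Y
      = secondForm κ τ φ N p (grad κ τ φ (meanCurvature κ τ φ N) p) Y := firstForm_sharp hM p _ Y
  have h4 : firstForm κ τ φ p (grad κ τ φ (meanCurvature κ τ φ N) p) Y
      = realDifferential (meanCurvature κ τ φ N) p Y := h1
  have h5 : firstForm κ τ φ p (ricciTangent κ τ φ N p) Y
      = (N p ᵥ* ricci (metric κ τ) (φ p)) ⬝ᵥ differential φ p Y := by
    refine (firstForm_sharp hM p _ Y).trans ?_
    simp [dotProduct]
  have h6 := frameNormal_dotProduct hM p Y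
  have h7 := vecMul_ricci κ τ (hM.mem_space p).ne' (N p) (differential φ p Y)
  have h8 : frameCoord κ τ (φ p) (differential φ p Y) = frameDifferential κ τ φ p Y := rfl
  rw [h8, h6] at h7
  have h9 := secondForm_apply hM p (grad κ τ φ (meanCurvature κ τ φ N) p) Y
  rw [← frameCovDeriv_apply hM] at h9
  linear_combination h2 - 2 * h3 - meanCurvature κ τ φ N p * h4 - 2 * h9
    + 2 * meanCurvature κ τ φ N p * (h5 + h7)

end Surface

/-! ### Structure equations in a parametrization -/

section Patch

variable {κ τ : ℝ} {E : Type*} [NormedAddCommGroup E] [NormedSpace ℝ E]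

theorem hasDerivAt_frameCoord {q w : ℝ → Fin 3 → ℝ} {v dw : Fin 3 → ℝ} {t : ℝ}
    (hq : HasDerivAt q v t) (hw : HasDerivAt w dw t) (hF : F κ (q t 0) (q t 1) ≠ 0) :
    HasDerivAt (fun s => frameCoord κ τ (q s) (w s)) (frameDeriv κ τ (q t) v (w t) dw) t := by
  rw [hasDerivAt_pi] at hq hw ⊢
  have hG : HasDerivAt (fun s => (F κ (q s 0) (q s 1))⁻¹)
      (-((κ / 2 * (q t 0 * v 0 + q t 1 * v 1)) / F κ (q t 0) (q t 1) ^ 2)) t := by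
    have h := ((((hq 0).pow 2).add ((hq 1).pow 2)).const_mul (κ / 4)).const_add 1
    refine (h.inv hF).congr_deriv ?_
    simp only [F, Pi.add_apply, Pi.pow_apply]
    ring
  intro i
  fin_cases i
  · simpa [frameDeriv] using hG.fun_mul (hw 0)
  · simpa [frameDeriv] using hG.fun_mul (hw 1)
  · simpa [frameDeriv] using (hw 2).fun_add ((hG.const_mul τ).fun_mul
      (((hq 1).fun_mul (hw 0)).fun_sub ((hq 0).fun_mul (hw 1))))

variable (κ τ) in
/-- The differential of a parametrization, in frame components. -/
def coframe (φ : E → Fin 3 → ℝ) (x : E) : E →L[ℝ] (Fin 3 → ℝ) :=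
  frameCoord κ τ (φ x) ∘L fderiv ℝ φ x

variable (κ τ) in
/-- The covariant derivative along the parametrization `φ` of the vector field with frame
components `n`. -/
def paramCov (φ n : E → Fin 3 → ℝ) (x v : E) : Fin 3 → ℝ :=
  frameCov κ τ (φ x 0) (φ x 1) (coframe κ τ φ x v) (n x) (fderiv ℝ n x v)

variable (κ τ) in
/-- A parametrized biconservative surface: `φ` is an immersion of the open set `U` of parameters,
`n` are the frame components of the unit normal and `f` is the mean curvature. -/
structure IsBiconservativeParam (U : Set E) (φ n : E → Fin 3 → ℝ) (f : E → ℝ) : Prop where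
  isOpen : IsOpen U
  smooth : ContDiffOn ℝ ∞ φ U
  smooth_normal : ContDiffOn ℝ ∞ n U
  smooth_curvature : ContDiffOn ℝ ∞ f U
  F_pos : ∀ x ∈ U, 0 < F κ (φ x 0) (φ x 1)
  injective : ∀ x ∈ U, Function.Injective (coframe κ τ φ x)
  unit : ∀ x ∈ U, n x ⬝ᵥ n x = 1
  orthogonal : ∀ x ∈ U, ∀ v, n x ⬝ᵥ coframe κ τ φ x v = 0
  trace : ∀ x ∈ U, ∀ v w,
    f x * tripleProduct (coframe κ τ φ x v) (coframe κ τ φ x w) (n x)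
      = -tripleProduct (paramCov κ τ φ n x v) (coframe κ τ φ x w) (n x)
        - tripleProduct (coframe κ τ φ x v) (paramCov κ τ φ n x w) (n x)
  biconservative : ∀ x ∈ U, ∃ G, ∀ v,
    coframe κ τ φ x G ⬝ᵥ coframe κ τ φ x v = fderiv ℝ f x v ∧
    -2 * (paramCov κ τ φ n x G ⬝ᵥ coframe κ τ φ x v) + f x * fderiv ℝ f x v
      = 2 * f x * ((4 * τ ^ 2 - κ) * (n x 2 * coframe κ τ φ x v 2))

theorem hasDerivAt_line {F' : Type*} [NormedAddCommGroup F'] [NormedSpace ℝ F'] {g : E → F'}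
    {x : E} (hg : DifferentiableAt ℝ g x) (u : E) :
    HasDerivAt (fun t : ℝ => g (x + t • u)) (fderiv ℝ g x u) 0 :=
  hg.hasFDerivAt.hasLineDerivAt u

theorem eventually_line_mem {U : Set E} (hU : IsOpen U) {x : E} (hx : x ∈ U) (u : E) :
    ∀ᶠ t : ℝ in nhds 0, x + t • u ∈ U := by
  have hc : Continuous fun t : ℝ => x + t • u := by fun_prop
  exact (hU.preimage hc).mem_nhds (by simpa using hx)

theorem hasDerivAt_fderiv_line {U : Set E} (hU : IsOpen U) {g : E → Fin 3 → ℝ}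
    (hg : ContDiffOn ℝ ∞ g U) {x : E} (hx : x ∈ U) (u v : E) :
    HasDerivAt (fun t : ℝ => fderiv ℝ g (x + t • u) v) (fderiv ℝ (fderiv ℝ g) x u v) 0 := by
  have h1 : ContDiffAt ℝ 1 (fderiv ℝ g) x :=
    ((hg.contDiffAt (hU.mem_nhds hx)).of_le (m := 2) ENat.LEInfty.out).fderiv_right (by norm_num)
  have h2 := hasDerivAt_line (h1.differentiableAt (by norm_num)) u
  simpa using h2.clm_apply (hasDerivAt_const (0 : ℝ) v)

theorem fderiv_fderiv_symm {U : Set E} (hU : IsOpen U) {g : E → Fin 3 → ℝ}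
    (hg : ContDiffOn ℝ ∞ g U) {x : E} (hx : x ∈ U) (u v : E) :
    fderiv ℝ (fderiv ℝ g) x u v = fderiv ℝ (fderiv ℝ g) x v u := by
  have h := (hg.contDiffAt (hU.mem_nhds hx)).isSymmSndFDerivAt
    (by simpa using ENat.LEInfty.out)
  exact h u v

namespace IsBiconservativeParam

variable {U : Set E} {φ n : E → Fin 3 → ℝ} {f : E → ℝ}

theorem differentiableAt (h : IsBiconservativeParam κ τ U φ n f) {x : E} (hx : x ∈ U) :
    DifferentiableAt ℝ φ x :=
  (h.smooth.contDiffAt (h.isOpen.mem_nhds hx)).differentiableAt (by simp)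

theorem differentiableAt_normal (h : IsBiconservativeParam κ τ U φ n f) {x : E} (hx : x ∈ U) :
    DifferentiableAt ℝ n x :=
  (h.smooth_normal.contDiffAt (h.isOpen.mem_nhds hx)).differentiableAt (by simp)

theorem differentiableAt_curvature (h : IsBiconservativeParam κ τ U φ n f) {x : E} (hx : x ∈ U) :
    DifferentiableAt ℝ f x :=
  (h.smooth_curvature.contDiffAt (h.isOpen.mem_nhds hx)).differentiableAt (by simp)

/-- Cartan's first structure equations for the coframe dual to `E₁, E₂, E₃`. -/
theorem exists_hasDerivAt_coframe (h : IsBiconservativeParam κ τ U φ n f) {x : E} (hx : x ∈ U) :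
    ∃ H : E → E → Fin 3 → ℝ,
      (∀ u v i, HasDerivAt (fun t : ℝ => coframe κ τ φ (x + t • u) v i) (H u v i) 0) ∧
      ∀ u v, let D := coframe κ τ φ x u 0 * coframe κ τ φ x v 1
          - coframe κ τ φ x u 1 * coframe κ τ φ x v 0
        H u v 0 - H v u 0 = κ / 2 * φ x 1 * D ∧ H u v 1 - H v u 1 = -(κ / 2 * φ x 0 * D) ∧
          H u v 2 - H v u 2 = -2 * τ * D := by
  refine ⟨fun u v => frameDeriv κ τ (φ x) (fderiv ℝ φ x u) (fderiv ℝ φ x v)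
    (fderiv ℝ (fderiv ℝ φ) x u v), fun u v i => ?_, fun u v => ?_⟩
  · have h1 := hasDerivAt_frameCoord (κ := κ) (τ := τ) (hasDerivAt_line (h.differentiableAt hx) u)
      (hasDerivAt_fderiv_line h.isOpen h.smooth hx u v) (by simpa using (h.F_pos x hx).ne')
    simp only [zero_smul, add_zero] at h1
    exact (hasDerivAt_pi.mp h1) i
  · have hF := (h.F_pos x hx).ne'
    have hs := fderiv_fderiv_symm h.isOpen h.smooth hx v u
    obtain ⟨G, hG⟩ : ∃ G, G = F κ (φ x 0) (φ x 1) := ⟨_, rfl⟩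
    have hG' := hG
    simp only [F] at hG'
    refine ⟨?_, ?_, ?_⟩ <;>
    · simp only [frameDeriv, coframe, hs, ContinuousLinearMap.comp_apply, frameCoord_zero,
        frameCoord_one, Matrix.cons_val]
      rw [← hG] at hF ⊢
      field_simp
      subst hG'
      ring

theorem sum_unit (h : IsBiconservativeParam κ τ U φ n f) {x : E} (hx : x ∈ U) :
    n x 0 ^ 2 + n x 1 ^ 2 + n x 2 ^ 2 = 1 := by
  have := h.unit x hx
  simp only [dotProduct, Fin.sum_univ_three] at this
  linear_combination this

theorem sum_orthogonal (h : IsBiconservativeParam κ τ U φ n f) {x : E} (hx : x ∈ U) (v : E) :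
    n x 0 * coframe κ τ φ x v 0 + n x 1 * coframe κ τ φ x v 1 + n x 2 * coframe κ τ φ x v 2
      = 0 := by
  have := h.orthogonal x hx v
  simpa only [dotProduct, Fin.sum_univ_three] using this

theorem hasDerivAt_normal (h : IsBiconservativeParam κ τ U φ n f) {x : E} (hx : x ∈ U) (u : E)
    (i : Fin 3) : HasDerivAt (fun t : ℝ => n (x + t • u) i) (fderiv ℝ n x u i) 0 :=
  (hasDerivAt_pi.mp (hasDerivAt_line (h.differentiableAt_normal hx) u)) i

theorem sum_fderiv_normal (h : IsBiconservativeParam κ τ U φ n f) {x : E} (hx : x ∈ U) (u : E) :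
    n x 0 * fderiv ℝ n x u 0 + n x 1 * fderiv ℝ n x u 1 + n x 2 * fderiv ℝ n x u 2 = 0 := by
  have h1 := ((((h.hasDerivAt_normal hx u 0).pow 2).add ((h.hasDerivAt_normal hx u 1).pow 2)).add
    ((h.hasDerivAt_normal hx u 2).pow 2))
  have h2 : HasDerivAt (fun _ : ℝ => (1 : ℝ)) 0 0 := hasDerivAt_const _ _
  have h3 := h1.unique (h2.congr_of_eventuallyEq (by
    filter_upwards [eventually_line_mem h.isOpen hx u] with t ht
    exact h.sum_unit ht))
  simp only [zero_smul, add_zero] at h3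
  linear_combination h3 / 2

/-- The second fundamental form is symmetric. -/
theorem paramCov_dotProduct_comm (h : IsBiconservativeParam κ τ U φ n f) {x : E} (hx : x ∈ U)
    (u v : E) : paramCov κ τ φ n x u ⬝ᵥ coframe κ τ φ x v
      = paramCov κ τ φ n x v ⬝ᵥ coframe κ τ φ x u := by
  obtain ⟨H, hH, hS⟩ := h.exists_hasDerivAt_coframe hx
  have key : ∀ u v, fderiv ℝ n x u 0 * coframe κ τ φ x v 0 + n x 0 * H u v 0
      + (fderiv ℝ n x u 1 * coframe κ τ φ x v 1 + n x 1 * H u v 1)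
      + (fderiv ℝ n x u 2 * coframe κ τ φ x v 2 + n x 2 * H u v 2) = 0 := by
    intro u v
    have h1 := (((h.hasDerivAt_normal hx u 0).mul (hH u v 0)).add
      ((h.hasDerivAt_normal hx u 1).mul (hH u v 1))).add
      ((h.hasDerivAt_normal hx u 2).mul (hH u v 2))
    have h2 : HasDerivAt (fun _ : ℝ => (0 : ℝ)) 0 0 := hasDerivAt_const _ _
    have h3 := h1.unique (h2.congr_of_eventuallyEq (by
      filter_upwards [eventually_line_mem h.isOpen hx u] with t ht
      exact h.sum_orthogonal ht v))
    simpa only [zero_smul, add_zero] using h3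
  obtain ⟨s0, s1, s2⟩ := hS u v
  have k1 := key u v
  have k2 := key v u
  simp only [paramCov, frameCov, rotationForm, dotProduct, Fin.sum_univ_three, Matrix.cons_val]
  linear_combination k1 - k2 - n x 0 * s0 - n x 1 * s1 - n x 2 * s2

end IsBiconservativeParam

end Patch

/-! ### Surfaces of constant angle or constant mean curvature in a parametrization -/

namespace IsBiconservativeParam

variable {κ τ : ℝ} {E : Type*} [NormedAddCommGroup E] [NormedSpace ℝ E]
  {U : Set E} {φ n : E → Fin 3 → ℝ} {f : E → ℝ}

theorem exists_coframe_eq (h : IsBiconservativeParam κ τ U φ n f)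
    (hE : Module.finrank ℝ E = 2) {x : E} (hx : x ∈ U) {b : Fin 3 → ℝ} (hb : n x ⬝ᵥ b = 0) :
    ∃ v, coframe κ τ φ x v = b :=
  exists_eq_of_dotProduct_eq_zero (a := (coframe κ τ φ x).toLinearMap) hE (h.injective x hx)
    (h.unit x hx) (h.orthogonal x hx) hb

/-- The tangential part `T` of the Hopf field and its rotation `W` by a right angle in the tangent
plane, as vectors of the parameter plane; away from the zeros of `T` they span that plane. -/
theorem exists_tangent_frame (h : IsBiconservativeParam κ τ U φ n f)
    (hE : Module.finrank ℝ E = 2) {x : E} (hx : x ∈ U) :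
    ∃ T W : E, coframe κ τ φ x T
        = ![-(n x 2 * n x 0), -(n x 2 * n x 1), n x 0 ^ 2 + n x 1 ^ 2] ∧
      coframe κ τ φ x W = ![-n x 1, n x 0, 0] ∧
      ∀ v, (n x 0 ^ 2 + n x 1 ^ 2) • v
        = (n x 0 * coframe κ τ φ x v 1 - n x 1 * coframe κ τ φ x v 0) • W
          + coframe κ τ φ x v 2 • T := by
  obtain ⟨T, hT⟩ := h.exists_coframe_eq hE hx
    (b := ![-(n x 2 * n x 0), -(n x 2 * n x 1), n x 0 ^ 2 + n x 1 ^ 2]) (by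
      simp only [dotProduct, Fin.sum_univ_three, Matrix.cons_val]; ring)
  obtain ⟨W, hW⟩ := h.exists_coframe_eq hE hx (b := ![-n x 1, n x 0, 0]) (by
      simp only [dotProduct, Fin.sum_univ_three, Matrix.cons_val]; ring)
  refine ⟨T, W, hT, hW, fun v => h.injective x hx ?_⟩
  have ho := h.sum_orthogonal hx v
  rw [map_add, map_smul, map_smul, map_smul, hT, hW]
  ext i
  fin_cases i <;> simp
  · linear_combination n x 0 * ho
  · linear_combination n x 1 * ho
  · ring

/-- `paramCov` is linear in the direction. -/
theorem paramCov_linear {x u v w : E} {r s t : ℝ} (hv : r • u = s • v + t • w) (i : Fin 3) :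
    r * paramCov κ τ φ n x u i = s * paramCov κ τ φ n x v i + t * paramCov κ τ φ n x w i := by
  have h1 : ∀ i, r * coframe κ τ φ x u i = s * coframe κ τ φ x v i + t * coframe κ τ φ x w i := by
    intro i
    simpa using congrFun (congrArg (coframe κ τ φ x) hv) i
  have h2 : ∀ i, r * fderiv ℝ n x u i = s * fderiv ℝ n x v i + t * fderiv ℝ n x w i := by
    intro i
    simpa using congrFun (congrArg (fderiv ℝ n x) hv) i
  fin_cases i <;> simp [paramCov, frameCov, rotationForm]
  · linear_combination h2 0 + (κ / 2 * φ x 0 * n x 1 + τ * n x 2) * h1 1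
      - κ / 2 * φ x 1 * n x 1 * h1 0 + τ * n x 1 * h1 2
  · linear_combination h2 1 - κ / 2 * φ x 0 * n x 0 * h1 1
      + (κ / 2 * φ x 1 * n x 0 - τ * n x 2) * h1 0 - τ * n x 0 * h1 2
  · linear_combination h2 2 + τ * n x 1 * h1 0 - τ * n x 0 * h1 1

section ConstantAngle

variable {ν : ℝ}

theorem fderiv_normal_two (h : IsBiconservativeParam κ τ U φ n f) (hν : ∀ x ∈ U, n x 2 = ν)
    {x : E} (hx : x ∈ U) (u : E) : fderiv ℝ n x u 2 = 0 := by
  have h2 : HasDerivAt (fun _ : ℝ => ν) 0 0 := hasDerivAt_const _ _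
  exact (h.hasDerivAt_normal hx u 2).unique (h2.congr_of_eventuallyEq (by
    filter_upwards [eventually_line_mem h.isOpen hx u] with t ht
    exact hν _ ht))

/-- The second fundamental form in the basis `T`, `W`, up to sign: constancy of the angle leaves only
the entry at `W`, `W` free, and this one is determined by the trace `f`. -/
theorem exists_tangent_frame_shape (h : IsBiconservativeParam κ τ U φ n f)
    (hE : Module.finrank ℝ E = 2) (hν : ∀ x ∈ U, n x 2 = ν) {x : E} (hx : x ∈ U) :
    ∃ T W : E, coframe κ τ φ x T = ![-(ν * n x 0), -(ν * n x 1), 1 - ν ^ 2] ∧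
      coframe κ τ φ x W = ![-n x 1, n x 0, 0] ∧
      (∀ v, (1 - ν ^ 2) • v
        = (n x 0 * coframe κ τ φ x v 1 - n x 1 * coframe κ τ φ x v 0) • W
          + coframe κ τ φ x v 2 • T) ∧
      paramCov κ τ φ n x T ⬝ᵥ coframe κ τ φ x T = 0 ∧
      paramCov κ τ φ n x T ⬝ᵥ coframe κ τ φ x W = -(τ * (1 - ν ^ 2)) ∧
      paramCov κ τ φ n x W ⬝ᵥ coframe κ τ φ x T = -(τ * (1 - ν ^ 2)) ∧
      paramCov κ τ φ n x W ⬝ᵥ coframe κ τ φ x W = -((1 - ν ^ 2) * f x) := by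
  obtain ⟨T, W, hT, hW, hspan⟩ := h.exists_tangent_frame hE hx
  have hu := h.sum_unit hx
  have hσ : n x 0 ^ 2 + n x 1 ^ 2 = 1 - ν ^ 2 := by rw [← hν x hx]; linear_combination hu
  rw [hν x hx, hσ] at hT
  rw [hσ] at hspan
  have dT := h.sum_fderiv_normal hx T
  have dW := h.sum_fderiv_normal hx W
  rw [h.fderiv_normal_two hν hx] at dT dW
  have hTT : paramCov κ τ φ n x T ⬝ᵥ coframe κ τ φ x T = 0 := by
    simp only [paramCov, frameCov, rotationForm, dotProduct, Fin.sum_univ_three, Matrix.cons_val,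
      hT, hν x hx, h.fderiv_normal_two hν hx]
    linear_combination (-ν) * dT
  have hWT : paramCov κ τ φ n x W ⬝ᵥ coframe κ τ φ x T = -(τ * (1 - ν ^ 2)) := by
    simp only [paramCov, frameCov, rotationForm, dotProduct, Fin.sum_univ_three, Matrix.cons_val,
      hT, hW, hν x hx, h.fderiv_normal_two hν hx]
    linear_combination (-ν) * dW - τ * hσ
  refine ⟨T, W, hT, hW, hspan, hTT, ?_, hWT, ?_⟩
  · rw [h.paramCov_dotProduct_comm hx, hWT]
  · have htr := h.trace x hx T W
    simp only [tripleProduct, hT, hW, hν x hx, Matrix.cons_val] at htr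
    simp only [dotProduct, Fin.sum_univ_three, hT, hW, Matrix.cons_val] at hTT ⊢
    linear_combination (-1 : ℝ) * htr - hTT
      - (paramCov κ τ φ n x T 2 + f x) * hσ

/-- The derivative of the direction of the horizontal part of the normal. -/
theorem rotation_normal (h : IsBiconservativeParam κ τ U φ n f)
    (hE : Module.finrank ℝ E = 2) (hν : ∀ x ∈ U, n x 2 = ν) (hσ : 1 - ν ^ 2 ≠ 0)
    {x : E} (hx : x ∈ U) (v : E) :
    n x 0 * fderiv ℝ n x v 1 - n x 1 * fderiv ℝ n x v 0
      = (1 - ν ^ 2) * rotationForm κ τ (φ x 0) (φ x 1) (coframe κ τ φ x v)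
        - f x * (n x 0 * coframe κ τ φ x v 1 - n x 1 * coframe κ τ φ x v 0)
        - τ * (1 + ν ^ 2) * coframe κ τ φ x v 2 := by
  obtain ⟨T, W, hT, hW, hspan, hTT, hTW, hWT, hWW⟩ := h.exists_tangent_frame_shape hE hν hx
  have hs : n x 0 ^ 2 + n x 1 ^ 2 = 1 - ν ^ 2 := by
    rw [← hν x hx]; linear_combination h.sum_unit hx
  have ho := h.sum_orthogonal hx v
  have hc := paramCov_linear (κ := κ) (τ := τ) (φ := φ) (n := n) (x := x) (hspan v)
  have c0 := hc 0
  have c1 := hc 1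
  simp only [dotProduct, Fin.sum_univ_three, hW, Matrix.cons_val] at hTW hWW
  -- the component of `c v` along `W`
  have hvW : (1 - ν ^ 2) * (n x 0 * paramCov κ τ φ n x v 1 - n x 1 * paramCov κ τ φ n x v 0)
      = (n x 0 * coframe κ τ φ x v 1 - n x 1 * coframe κ τ φ x v 0) * -((1 - ν ^ 2) * f x)
        + coframe κ τ φ x v 2 * -(τ * (1 - ν ^ 2)) := by
    linear_combination n x 0 * c1 - n x 1 * c0 + coframe κ τ φ x v 2 * hTW
      + (n x 0 * coframe κ τ φ x v 1 - n x 1 * coframe κ τ φ x v 0) * hWW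
  have hvW' : n x 0 * paramCov κ τ φ n x v 1 - n x 1 * paramCov κ τ φ n x v 0
      = -((n x 0 * coframe κ τ φ x v 1 - n x 1 * coframe κ τ φ x v 0) * f x)
        - coframe κ τ φ x v 2 * τ := by
    apply mul_left_cancel₀ hσ
    linear_combination hvW
  simp only [paramCov, frameCov, Matrix.cons_val, hν x hx] at hvW' ho
  linear_combination hvW' + rotationForm κ τ (φ x 0) (φ x 1) (coframe κ τ φ x v) * hs
    + τ * ν * ho

/-- The Codazzi equation of a surface of constant angle, in the direction of the tangential part of
the Hopf field: it is the integrability condition of `rotation_normal`. -/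
theorem fderiv_curvature_tangent (h : IsBiconservativeParam κ τ U φ n f)
    (hE : Module.finrank ℝ E = 2) (hν : ∀ x ∈ U, n x 2 = ν) (hσ : 1 - ν ^ 2 ≠ 0)
    {x : E} (hx : x ∈ U) {T W : E}
    (hT : coframe κ τ φ x T = ![-(ν * n x 0), -(ν * n x 1), 1 - ν ^ 2])
    (hW : coframe κ τ φ x W = ![-n x 1, n x 0, 0]) :
    fderiv ℝ f x T = -ν * (f x ^ 2 + κ * (1 - ν ^ 2) + 4 * τ ^ 2 * ν ^ 2) := by
  obtain ⟨H, hH, hS⟩ := h.exists_hasDerivAt_coframe hx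
  have key : ∀ u v, _ := fun u v => by
    have n0 := h.hasDerivAt_normal hx u 0
    have n1 := h.hasDerivAt_normal hx u 1
    have p0 := (hasDerivAt_pi.mp (hasDerivAt_line (h.differentiableAt hx) u)) 0
    have p1 := (hasDerivAt_pi.mp (hasDerivAt_line (h.differentiableAt hx) u)) 1
    have hB := hasDerivAt_pi.mp (hasDerivAt_fderiv_line h.isOpen h.smooth_normal hx u v)
    have hf := hasDerivAt_line (h.differentiableAt_curvature hx) u
    have hl := (n0.fun_mul (hB 1)).fun_sub (n1.fun_mul (hB 0))
    have hr := (((((p0.fun_mul (hH u v 1)).fun_sub (p1.fun_mul (hH u v 0))).const_mul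
      (κ / 2)).fun_add ((hH u v 2).const_mul τ)).const_mul (1 - ν ^ 2)).fun_sub (hf.fun_mul
      ((n0.fun_mul (hH u v 1)).fun_sub (n1.fun_mul (hH u v 0)))) |>.fun_sub
      ((hH u v 2).const_mul (τ * (1 + ν ^ 2)))
    have he := hl.unique (hr.congr_of_eventuallyEq (by
      filter_upwards [eventually_line_mem h.isOpen hx u] with t ht
      exact h.rotation_normal hE hν hσ ht v))
    simp only [zero_smul, add_zero] at he
    exact he
  have k1 := key T W
  have k2 := key W T
  have hB := fderiv_fderiv_symm h.isOpen h.smooth_normal hx T W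
  rw [← hB] at k2
  obtain ⟨s0, s1, s2⟩ := hS T W
  have hs : n x 0 ^ 2 + n x 1 ^ 2 = 1 - ν ^ 2 := by
    rw [← hν x hx]; linear_combination h.sum_unit hx
  have rW := h.rotation_normal hE hν hσ hx W
  have dT := h.sum_fderiv_normal hx T
  have dW := h.sum_fderiv_normal hx W
  have hφ : ∀ v, fderiv ℝ φ x v 0 = F κ (φ x 0) (φ x 1) * coframe κ τ φ x v 0 ∧
      fderiv ℝ φ x v 1 = F κ (φ x 0) (φ x 1) * coframe κ τ φ x v 1 := by
    intro v
    have := (h.F_pos x hx).ne'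
    constructor <;> simp [coframe] <;> field_simp
  simp only [h.fderiv_normal_two hν hx, hν x hx, (hφ _).1, (hφ _).2, rotationForm, hT, hW,
    Matrix.cons_val, F] at k1 k2 s0 s1 s2 rW dT dW
  -- `dn ∧ dn = 0`, since both derivatives are orthogonal to `(n₀, n₁)`
  have hpr : fderiv ℝ n x T 0 * fderiv ℝ n x W 1 - fderiv ℝ n x T 1 * fderiv ℝ n x W 0 = 0 := by
    apply mul_left_cancel₀ hσ
    linear_combination (-(fderiv ℝ n x T 0 * fderiv ℝ n x W 1
        - fderiv ℝ n x T 1 * fderiv ℝ n x W 0)) * hs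
      + (n x 0 * fderiv ℝ n x W 1 - n x 1 * fderiv ℝ n x W 0) * dT
      - (n x 0 * fderiv ℝ n x T 1 - n x 1 * fderiv ℝ n x T 0) * dW
  have hD : -(ν * n x 0) * n x 0 - -(ν * n x 1) * -n x 1 = -(ν * (1 - ν ^ 2)) := by
    linear_combination (-ν) * hs
  rw [hD] at s0 s1 s2
  apply mul_right_cancel₀ hσ
  linear_combination k1 - k2 - 2 * hpr
    + (-((1 - ν ^ 2) * κ / 2 * φ x 1) + f x * n x 1) * s0
    + ((1 - ν ^ 2) * κ / 2 * φ x 0 - f x * n x 0) * s1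
    + ((1 - ν ^ 2) * τ - τ * (1 + ν ^ 2)) * s2 - f x * dT + f x * ν * rW
    - (fderiv ℝ f x T + f x ^ 2 * ν
      + ν * (1 - ν ^ 2) * κ * (1 + κ / 4 * (φ x 0 ^ 2 + φ x 1 ^ 2))) * hs

/-- The biconservative equation in the basis `T`, `W`. -/
theorem biconservative_tangent_frame (h : IsBiconservativeParam κ τ U φ n f)
    (hE : Module.finrank ℝ E = 2) (hν : ∀ x ∈ U, n x 2 = ν) (hσ : 1 - ν ^ 2 ≠ 0)
    {x : E} (hx : x ∈ U) :
    ∃ T W : E, coframe κ τ φ x T = ![-(ν * n x 0), -(ν * n x 1), 1 - ν ^ 2] ∧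
      coframe κ τ φ x W = ![-n x 1, n x 0, 0] ∧
      (∀ v, (1 - ν ^ 2) • v
        = (n x 0 * coframe κ τ φ x v 1 - n x 1 * coframe κ τ φ x v 0) • W
          + coframe κ τ φ x v 2 • T) ∧
      2 * τ * fderiv ℝ f x W + f x * fderiv ℝ f x T
        = 2 * f x * ((4 * τ ^ 2 - κ) * (ν * (1 - ν ^ 2))) ∧
      2 * τ * fderiv ℝ f x T + 3 * f x * fderiv ℝ f x W = 0 := by
  obtain ⟨T, W, hT, hW, hspan, hTT, hTW, hWT, hWW⟩ := h.exists_tangent_frame_shape hE hν hx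
  obtain ⟨G, hG⟩ := h.biconservative x hx
  have hs : n x 0 ^ 2 + n x 1 ^ 2 = 1 - ν ^ 2 := by
    rw [← hν x hx]; linear_combination h.sum_unit hx
  have ho := h.sum_orthogonal hx G
  have hc := paramCov_linear (κ := κ) (τ := τ) (φ := φ) (n := n) (x := x) (hspan G)
  have c0 := hc 0
  have c1 := hc 1
  have c2 := hc 2
  obtain ⟨gT, bT⟩ := hG T
  obtain ⟨gW, bW⟩ := hG W
  refine ⟨T, W, hT, hW, hspan, ?_, ?_⟩
  all_goals
    simp only [dotProduct, Fin.sum_univ_three, hT, hW, Matrix.cons_val, hν x hx]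
      at hTT hTW hWT hWW gT bT gW bW ho
    -- the coordinates of the gradient in the basis `T`, `W`
    have g2 : coframe κ τ φ x G 2 = fderiv ℝ f x T := by
      rw [← gT]; linear_combination ν * ho
    have gw : n x 0 * coframe κ τ φ x G 1 - n x 1 * coframe κ τ φ x G 0 = fderiv ℝ f x W := by
      rw [← gW]; ring
    rw [g2, gw] at c0 c1 c2
    apply mul_left_cancel₀ hσ
  · linear_combination (1 - ν ^ 2) * bT - 2 * ν * n x 0 * c0 - 2 * ν * n x 1 * c1
      + 2 * (1 - ν ^ 2) * c2 + 2 * fderiv ℝ f x W * hWT + 2 * fderiv ℝ f x T * hTT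
  · linear_combination (1 - ν ^ 2) * bW - 2 * n x 1 * c0 + 2 * n x 0 * c1
      + 2 * fderiv ℝ f x W * hWW + 2 * fderiv ℝ f x T * hTW

theorem smul_fderiv_curvature_of_angle_right (h : IsBiconservativeParam κ τ U φ n f)
    (hE : Module.finrank ℝ E = 2) (hν : ∀ x ∈ U, n x 2 = 0) {x : E} (hx : x ∈ U) :
    (3 * f x ^ 2 - 4 * τ ^ 2) • fderiv ℝ f x = 0 := by
  obtain ⟨T, W, hT, hW, hspan, e1, e2⟩ := h.biconservative_tangent_frame hE hν (by simp) hx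
  have hT0 : (3 * f x ^ 2 - 4 * τ ^ 2) * fderiv ℝ f x T = 0 := by
    linear_combination 3 * f x * e1 - 2 * τ * e2
  have hW0 : (3 * f x ^ 2 - 4 * τ ^ 2) * fderiv ℝ f x W = 0 := by
    linear_combination f x * e2 - 2 * τ * e1
  ext v
  have hv := congrArg (fderiv ℝ f x) (hspan v)
  simp only [map_add, map_smul, smul_eq_mul] at hv
  simp only [smul_apply, smul_eq_mul, zero_apply]
  linear_combination (3 * f x ^ 2 - 4 * τ ^ 2) * hv + coframe κ τ φ x v 2 * hT0
    + (n x 0 * coframe κ τ φ x v 1 - n x 1 * coframe κ τ φ x v 0) * hW0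

/-- The mean curvature of a surface of constant oblique angle is a root of a fixed polynomial, which
has degree four. -/
theorem curvature_polynomial_of_angle_oblique (h : IsBiconservativeParam κ τ U φ n f)
    (hE : Module.finrank ℝ E = 2) (hν : ∀ x ∈ U, n x 2 = ν) (hν0 : ν ≠ 0) (hσ : 1 - ν ^ 2 ≠ 0)
    {x : E} (hx : x ∈ U) :
    (f x ^ 2 + (κ * (1 - ν ^ 2) + 4 * τ ^ 2 * ν ^ 2)) * (3 * f x ^ 2 - 4 * τ ^ 2)
      + 6 * (1 - ν ^ 2) * (4 * τ ^ 2 - κ) * f x ^ 2 = 0 := by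
  obtain ⟨T, W, hT, hW, hspan, e1, e2⟩ := h.biconservative_tangent_frame hE hν hσ hx
  have e3 := h.fderiv_curvature_tangent hE hν hσ hx hT hW
  apply mul_left_cancel₀ hν0
  linear_combination (-3 * f x) * e1 + 2 * τ * e2 + (3 * f x ^ 2 - 4 * τ ^ 2) * e3

end ConstantAngle

/-- A surface orthogonal to the Hopf field is minimal. -/
theorem curvature_eq_zero_of_vertical (h : IsBiconservativeParam κ τ U φ n f)
    (hE : Module.finrank ℝ E = 2) (h0 : ∀ x ∈ U, n x 0 = 0 ∧ n x 1 = 0) {x : E} (hx : x ∈ U) :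
    f x = 0 := by
  have hd : ∀ u i, (∀ y ∈ U, n y i = 0) → fderiv ℝ n x u i = 0 := by
    intro u i hi
    have h2 : HasDerivAt (fun _ : ℝ => (0 : ℝ)) 0 0 := hasDerivAt_const _ _
    exact (h.hasDerivAt_normal hx u i).unique (h2.congr_of_eventuallyEq (by
      filter_upwards [eventually_line_mem h.isOpen hx u] with t ht
      exact hi _ ht))
  obtain ⟨n0, n1⟩ := h0 x hx
  have hu := h.sum_unit hx
  obtain ⟨v, hv⟩ := h.exists_coframe_eq hE hx (b := ![1, 0, 0]) (by
    simp [dotProduct, Fin.sum_univ_three, n0])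
  obtain ⟨w, hw⟩ := h.exists_coframe_eq hE hx (b := ![0, 1, 0]) (by
    simp [dotProduct, Fin.sum_univ_three, n1])
  have htr := h.trace x hx v w
  have d0 := fun u => hd u 0 fun y hy => (h0 y hy).1
  have d1 := fun u => hd u 1 fun y hy => (h0 y hy).2
  simp [tripleProduct, paramCov, frameCov, hv, hw, d0, d1, n0, n1] at htr hu
  rcases htr with htr | htr
  · exact htr
  · simp [htr] at hu

section ConstantMeanCurvature

/-- On a surface of constant nonzero mean curvature, `Ricci(N)ᵀ = (4τ² - κ) ν T` vanishes, so that
`ν = 0` or `T = 0`. -/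
theorem vertical_or_horizontal (h : IsBiconservativeParam κ τ U φ n f)
    (hE : Module.finrank ℝ E = 2) (hκτ : κ ≠ 4 * τ ^ 2) {c : ℝ} (hc : c ≠ 0)
    (hf : ∀ x ∈ U, f x = c) {x : E} (hx : x ∈ U) :
    n x 2 = 0 ∨ n x 0 = 0 ∧ n x 1 = 0 := by
  obtain ⟨T, W, hT, hW, hspan⟩ := h.exists_tangent_frame hE hx
  obtain ⟨G, hG⟩ := h.biconservative x hx
  have hd : fderiv ℝ f x = 0 := by
    have : f =ᶠ[nhds x] fun _ => c := by
      filter_upwards [h.isOpen.mem_nhds hx] with y hy using hf y hy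
    rw [this.fderiv_eq]; simp
  have hG0 : G = 0 := by
    have := (hG G).1
    rw [hd] at this
    simp only [zero_apply, dotProduct_self_eq_zero] at this
    exact (map_eq_zero_iff _ (h.injective x hx)).mp this
  have h1 := (hG T).2
  have hz : paramCov κ τ φ n x G = 0 := by
    subst hG0
    ext i
    fin_cases i <;> simp [paramCov, frameCov, rotationForm]
  rw [hz, hd, hf x hx, hT] at h1
  simp only [zero_dotProduct, zero_apply, mul_zero, add_zero, Matrix.cons_val] at h1
  have h2 : n x 2 * (n x 0 ^ 2 + n x 1 ^ 2) = 0 := by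
    have h3 : 2 * c * (4 * τ ^ 2 - κ) ≠ 0 :=
      mul_ne_zero (mul_ne_zero two_ne_zero hc) (sub_ne_zero.mpr hκτ.symm)
    apply mul_left_cancel₀ h3
    linear_combination -h1
  rcases mul_eq_zero.mp h2 with h3 | h3
  · exact Or.inl h3
  · right
    constructor <;> nlinarith [sq_nonneg (n x 0), sq_nonneg (n x 1)]

/-- For a horizontal normal, the projection of the normal to the base turns along the surface like
the normal of a plane curve whose curvature in the Euclidean plane is `(f - (κ/2) n·p) / F`, up to
sign. -/
theorem fderiv_normal_of_horizontal (h : IsBiconservativeParam κ τ U φ n f)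
    (hE : Module.finrank ℝ E = 2) (hν : ∀ x ∈ U, n x 2 = 0) {x : E} (hx : x ∈ U) (v : E) :
    F κ (φ x 0) (φ x 1) * fderiv ℝ n x v 0
        = -(f x - κ / 2 * (n x 0 * φ x 0 + n x 1 * φ x 1)) * fderiv ℝ φ x v 0 ∧
      F κ (φ x 0) (φ x 1) * fderiv ℝ n x v 1
        = -(f x - κ / 2 * (n x 0 * φ x 0 + n x 1 * φ x 1)) * fderiv ℝ φ x v 1 := by
  have hr := h.rotation_normal hE hν (by simp) hx v
  have hd := h.sum_fderiv_normal hx v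
  have ho := h.sum_orthogonal hx v
  have hu := h.sum_unit hx
  have hF := (h.F_pos x hx).ne'
  have hφ0 : fderiv ℝ φ x v 0 = F κ (φ x 0) (φ x 1) * coframe κ τ φ x v 0 := by
    simp [coframe]; field_simp
  have hφ1 : fderiv ℝ φ x v 1 = F κ (φ x 0) (φ x 1) * coframe κ τ φ x v 1 := by
    simp [coframe]; field_simp
  rw [hφ0, hφ1]
  simp only [hν x hx, h.fderiv_normal_two hν hx, rotationForm] at hr hd ho hu
  have h0 : fderiv ℝ n x v 0 = -(f x - κ / 2 * (n x 0 * φ x 0 + n x 1 * φ x 1))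
      * coframe κ τ φ x v 0 := by
    linear_combination (-fderiv ℝ n x v 0 - f x * coframe κ τ φ x v 0) * hu + n x 0 * hd
      - n x 1 * hr + (f x * n x 0 - κ / 2 * φ x 0) * ho
  have h1 : fderiv ℝ n x v 1 = -(f x - κ / 2 * (n x 0 * φ x 0 + n x 1 * φ x 1))
      * coframe κ τ φ x v 1 := by
    linear_combination (-fderiv ℝ n x v 1 - f x * coframe κ τ φ x v 1) * hu + n x 1 * hd
      + n x 0 * hr + (f x * n x 1 - κ / 2 * φ x 1) * ho
  constructor
  · rw [h0]; ring
  · rw [h1]; ring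

end ConstantMeanCurvature

end IsBiconservativeParam

/-! ### Parametrizations of a surface by charts -/

section Chart

variable {M : Type*} [TopologicalSpace M] [ChartedSpace (EuclideanSpace ℝ (Fin 2)) M]

/-- The expression of a map on the surface in the chart at `p`. -/
def inChart {X : Type*} (p : M) (u : M → X) (x : EuclideanSpace ℝ (Fin 2)) : X :=
  u ((extChartAt (𝓡 2) p).symm x)

/-- The domain of the coordinates of the chart at `p`. -/
def chartDomain (p : M) : Set (EuclideanSpace ℝ (Fin 2)) := (extChartAt (𝓡 2) p).target

theorem isOpen_chartDomain (p : M) : IsOpen (chartDomain p) := isOpen_extChartAt_target p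

/-- The isomorphism from the parameter plane to the tangent plane given by the chart at `p`. -/
def chartTangent (p : M) (x : EuclideanSpace ℝ (Fin 2)) :
    EuclideanSpace ℝ (Fin 2) →L[ℝ] TangentSpace (𝓡 2) ((extChartAt (𝓡 2) p).symm x) :=
  mfderiv 𝓘(ℝ, EuclideanSpace ℝ (Fin 2)) (𝓡 2) (extChartAt (𝓡 2) p).symm x

variable [IsManifold (𝓡 2) ∞ M] {p : M} {x : EuclideanSpace ℝ (Fin 2)}

theorem chartTangent_bijective (hx : x ∈ chartDomain p) :
    Function.Bijective (chartTangent p x) := by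
  have : IsManifold (𝓡 2) 1 M := IsManifold.of_le (n := ∞) (by simp)
  have h := isInvertible_mfderivWithin_extChartAt_symm (I := 𝓡 2) (x := p) (y := x) hx
  rw [ModelWithCorners.range_eq_univ, mfderivWithin_univ] at h
  exact h.bijective

theorem mdifferentiableAt_chart_symm (hx : x ∈ chartDomain p) :
    MDifferentiableAt 𝓘(ℝ, EuclideanSpace ℝ (Fin 2)) (𝓡 2) (extChartAt (𝓡 2) p).symm x :=
  ((contMDiffOn_extChartAt_symm (n := ∞) p).contMDiffAt
    ((isOpen_chartDomain p).mem_nhds hx)).mdifferentiableAt (by simp)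

theorem contDiffOn_inChart {n : ℕ} {u : M → Fin n → ℝ}
    (hu : ContMDiff (𝓡 2) 𝓘(ℝ, Fin n → ℝ) ∞ u) (p : M) :
    ContDiffOn ℝ ∞ (inChart p u) (chartDomain p) :=
  (hu.comp_contMDiffOn (contMDiffOn_extChartAt_symm p)).contDiffOn

theorem fderiv_inChart {n : ℕ} {u : M → Fin n → ℝ}
    (hu : ContMDiff (𝓡 2) 𝓘(ℝ, Fin n → ℝ) ∞ u) (hx : x ∈ chartDomain p)
    (v : EuclideanSpace ℝ (Fin 2)) :
    fderiv ℝ (inChart p u) x v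
      = differential u ((extChartAt (𝓡 2) p).symm x) (chartTangent p x v) := by
  have h := mfderiv_comp_apply x (hu.mdifferentiableAt (by simp))
    (mdifferentiableAt_chart_symm hx) v
  rw [mfderiv_eq_fderiv] at h
  exact h

theorem fderiv_inChart_real {u : M → ℝ}
    (hu : DifferentiableAt ℝ (inChart p u) x) (hx : x ∈ chartDomain p)
    (v : EuclideanSpace ℝ (Fin 2)) :
    fderiv ℝ (inChart p u) x v
      = realDifferential u ((extChartAt (𝓡 2) p).symm x) (chartTangent p x v) := by
  set q := (extChartAt (𝓡 2) p).symm x with hq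
  have hqs : q ∈ (extChartAt (𝓡 2) p).source := (extChartAt (𝓡 2) p).map_target hx
  have hqx : extChartAt (𝓡 2) p q = x := (extChartAt (𝓡 2) p).right_inv hx
  have hd : MDifferentiableAt (𝓡 2) 𝓘(ℝ, ℝ) u q := by
    have h1 : MDifferentiableAt (𝓡 2) 𝓘(ℝ, ℝ) (inChart p u ∘ extChartAt (𝓡 2) p) q := by
      refine MDifferentiableAt.comp q (I' := 𝓘(ℝ, EuclideanSpace ℝ (Fin 2))) ?_ ?_
      · rw [hqx]; exact hu.mdifferentiableAt
      · exact ((contMDiffAt_extChartAt' (n := ∞)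
          (by simpa using hqs)).mdifferentiableAt (by simp))
    refine h1.congr_of_eventuallyEq ?_
    filter_upwards [(isOpen_extChartAt_source (I := 𝓡 2) p).mem_nhds hqs] with y hy
    simp only [inChart, Function.comp_apply]
    rw [(extChartAt (𝓡 2) p).left_inv hy]
  have h := mfderiv_comp_apply x hd (mdifferentiableAt_chart_symm hx) v
  rw [mfderiv_eq_fderiv] at h
  exact h

end Chart

section Transfer

variable {κ τ : ℝ}

theorem contDiffOn_frameCoord {E : Type*} [NormedAddCommGroup E] [NormedSpace ℝ E] {U : Set E}
    {q w : E → Fin 3 → ℝ} {m : WithTop ℕ∞} (hq : ContDiffOn ℝ m q U) (hw : ContDiffOn ℝ m w U)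
    (hF : ∀ x ∈ U, F κ (q x 0) (q x 1) ≠ 0) :
    ContDiffOn ℝ m (fun x => frameCoord κ τ (q x) (w x)) U := by
  rw [contDiffOn_pi] at hq hw ⊢
  have hG : ContDiffOn ℝ m (fun x => (F κ (q x 0) (q x 1))⁻¹) U := by
    refine ContDiffOn.inv ?_ hF
    exact contDiffOn_const.add (contDiffOn_const.mul (((hq 0).pow 2).add ((hq 1).pow 2)))
  intro i
  fin_cases i
  · simpa using hG.mul (hw 0)
  · simpa using hG.mul (hw 1)
  · simpa using (hw 2).add ((contDiffOn_const.mul hG).mul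
      (((hq 1).mul (hw 0)).sub ((hq 0).mul (hw 1))))

theorem exists_orthogonal_tripleProduct_ne_zero {n : Fin 3 → ℝ} (hn : n ⬝ᵥ n = 1) :
    ∃ b c : Fin 3 → ℝ, n ⬝ᵥ b = 0 ∧ n ⬝ᵥ c = 0 ∧ tripleProduct b c n ≠ 0 := by
  simp only [dotProduct, Fin.sum_univ_three] at hn
  by_cases h2 : n 2 = 0
  · by_cases h1 : n 1 = 0
    · refine ⟨![0, 1, 0], ![0, 0, 1], ?_, ?_, ?_⟩
      · simp [dotProduct, Fin.sum_univ_three, h1]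
      · simp [dotProduct, Fin.sum_univ_three, h2]
      · simp only [tripleProduct, Matrix.cons_val]
        intro h
        simp only [h1, h2] at hn
        nlinarith
    · refine ⟨![n 1, -n 0, 0], ![0, 0, 1], ?_, ?_, ?_⟩
      · simp [dotProduct, Fin.sum_univ_three]; ring
      · simp [dotProduct, Fin.sum_univ_three, h2]
      · simp only [tripleProduct, Matrix.cons_val]
        intro h
        simp only [h2] at hn
        nlinarith
  · refine ⟨![n 2, 0, -n 0], ![0, n 2, -n 1], ?_, ?_, ?_⟩
    · simp [dotProduct, Fin.sum_univ_three]; ring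
    · simp [dotProduct, Fin.sum_univ_three]; ring
    · simp only [tripleProduct, Matrix.cons_val]
      intro h
      apply h2
      linear_combination h - n 2 * hn

variable {M : Type*} [TopologicalSpace M] [ChartedSpace (EuclideanSpace ℝ (Fin 2)) M]
  {φ N : M → Fin 3 → ℝ}

variable (κ τ φ N) in
/-- The components of the unit normal in the orthonormal frame. -/
def frameNormal (p : M) : Fin 3 → ℝ := frameCoord κ τ (φ p) (N p)

variable [IsManifold (𝓡 2) ∞ M] {p : M} {x : EuclideanSpace ℝ (Fin 2)}

theorem coframe_inChart (hM : IsOrientedSurface κ τ φ N) (hx : x ∈ chartDomain p)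
    (v : EuclideanSpace ℝ (Fin 2)) : coframe κ τ (inChart p φ) x v
      = frameDifferential κ τ φ ((extChartAt (𝓡 2) p).symm x) (chartTangent p x v) :=
  congrArg (frameCoord κ τ (inChart p φ x)) (fderiv_inChart hM.smooth hx v)

theorem contDiffOn_frameNormal (hM : IsOrientedSurface κ τ φ N) (p : M) :
    ContDiffOn ℝ ∞ (inChart p (frameNormal κ τ φ N)) (chartDomain p) :=
  contDiffOn_frameCoord (contDiffOn_inChart hM.smooth p) (contDiffOn_inChart hM.smooth_normal p)
    fun _ _ => (hM.mem_space _).ne'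

theorem fderiv_frameNormal (hM : IsOrientedSurface κ τ φ N) (hx : x ∈ chartDomain p)
    (v : EuclideanSpace ℝ (Fin 2)) : fderiv ℝ (inChart p (frameNormal κ τ φ N)) x v
      = frameDeriv κ τ (φ ((extChartAt (𝓡 2) p).symm x))
        (differential φ ((extChartAt (𝓡 2) p).symm x) (chartTangent p x v))
        (N ((extChartAt (𝓡 2) p).symm x))
        (differential N ((extChartAt (𝓡 2) p).symm x) (chartTangent p x v)) := by
  have hU := (isOpen_chartDomain p).mem_nhds hx
  have h1 := hasDerivAt_line (((contDiffOn_frameNormal hM p).contDiffAt hU).differentiableAt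
    (by simp)) v
  have h2 := hasDerivAt_frameCoord (κ := κ) (τ := τ)
    (hasDerivAt_line (((contDiffOn_inChart hM.smooth p).contDiffAt hU).differentiableAt
      (by simp)) v)
    (hasDerivAt_line (((contDiffOn_inChart hM.smooth_normal p).contDiffAt hU).differentiableAt
      (by simp)) v) (hM.mem_space _).ne'
  have h3 := h1.unique h2
  rw [fderiv_inChart hM.smooth hx, fderiv_inChart hM.smooth_normal hx] at h3
  simpa only [zero_smul, add_zero, inChart] using h3

theorem paramCov_inChart (hM : IsOrientedSurface κ τ φ N) (hx : x ∈ chartDomain p)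
    (v : EuclideanSpace ℝ (Fin 2)) :
    paramCov κ τ (inChart p φ) (inChart p (frameNormal κ τ φ N)) x v
      = frameCovDeriv κ τ φ N ((extChartAt (𝓡 2) p).symm x) (chartTangent p x v) := by
  rw [frameCovDeriv_apply hM, paramCov, coframe_inChart hM hx, fderiv_frameNormal hM hx]
  rfl

theorem trace_inChart (hM : IsOrientedSurface κ τ φ N) (hx : x ∈ chartDomain p)
    (v w : EuclideanSpace ℝ (Fin 2)) :
    inChart p (meanCurvature κ τ φ N) x * tripleProduct (coframe κ τ (inChart p φ) x v)
        (coframe κ τ (inChart p φ) x w) (inChart p (frameNormal κ τ φ N) x)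
      = -tripleProduct (paramCov κ τ (inChart p φ) (inChart p (frameNormal κ τ φ N)) x v)
          (coframe κ τ (inChart p φ) x w) (inChart p (frameNormal κ τ φ N) x)
        - tripleProduct (coframe κ τ (inChart p φ) x v)
          (paramCov κ τ (inChart p φ) (inChart p (frameNormal κ τ φ N)) x w)
          (inChart p (frameNormal κ τ φ N) x) := by
  rw [coframe_inChart hM hx, coframe_inChart hM hx, paramCov_inChart hM hx,
    paramCov_inChart hM hx]
  exact meanCurvature_mul_tripleProduct hM _ _ _

theorem coframe_inChart_injective (hM : IsOrientedSurface κ τ φ N) (hx : x ∈ chartDomain p) :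
    Function.Injective (coframe κ τ (inChart p φ) x) := by
  intro v w hvw
  rw [coframe_inChart hM hx, coframe_inChart hM hx] at hvw
  exact (chartTangent_bijective hx).1 (frameDifferential_injective hM _ hvw)

theorem normal_dotProduct_coframe (hM : IsOrientedSurface κ τ φ N) (hx : x ∈ chartDomain p)
    (v : EuclideanSpace ℝ (Fin 2)) :
    inChart p (frameNormal κ τ φ N) x ⬝ᵥ coframe κ τ (inChart p φ) x v = 0 := by
  rw [coframe_inChart hM hx]
  exact frameNormal_dotProduct hM _ _

/-- The mean curvature is smooth: by `trace_inChart` it is locally a quotient of smooth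
functions. -/
theorem contDiffOn_meanCurvature (hM : IsOrientedSurface κ τ φ N) (p : M) :
    ContDiffOn ℝ ∞ (inChart p (meanCurvature κ τ φ N)) (chartDomain p) := by
  intro x hx
  refine ContDiffAt.contDiffWithinAt ?_
  have hU := (isOpen_chartDomain p).mem_nhds hx
  have hn1 : inChart p (frameNormal κ τ φ N) x ⬝ᵥ inChart p (frameNormal κ τ φ N) x = 1 :=
    frameNormal_dotProduct_self hM _
  obtain ⟨b, c, hb, hc, hbc⟩ := exists_orthogonal_tripleProduct_ne_zero hn1
  have hE : Module.finrank ℝ (EuclideanSpace ℝ (Fin 2)) = 2 := by simp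
  obtain ⟨v, hv⟩ := exists_eq_of_dotProduct_eq_zero
    (a := (coframe κ τ (inChart p φ) x).toLinearMap) hE
    (coframe_inChart_injective hM hx) hn1 (normal_dotProduct_coframe hM hx) hb
  obtain ⟨w, hw⟩ := exists_eq_of_dotProduct_eq_zero
    (a := (coframe κ τ (inChart p φ) x).toLinearMap) hE
    (coframe_inChart_injective hM hx) hn1 (normal_dotProduct_coframe hM hx) hc
  have hφ := contDiffOn_inChart hM.smooth p
  have hn := (contDiffOn_frameNormal hM p).contDiffAt hU
  have hcof : ∀ u, ContDiffAt ℝ ∞ (fun y => coframe κ τ (inChart p φ) y u) x := fun u =>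
    (contDiffOn_frameCoord hφ (((hφ.fderiv_of_isOpen (isOpen_chartDomain p) (by simp)).clm_apply
      contDiffOn_const)) fun _ _ => (hM.mem_space _).ne').contDiffAt hU
  have hdn : ∀ u, ContDiffAt ℝ ∞ (fun y => fderiv ℝ (inChart p (frameNormal κ τ φ N)) y u) x :=
    fun u => (((contDiffOn_frameNormal hM p).fderiv_of_isOpen (isOpen_chartDomain p)
      (by simp)).clm_apply contDiffOn_const).contDiffAt hU
  have hφx := hφ.contDiffAt hU
  have htp : ∀ {a b c : EuclideanSpace ℝ (Fin 2) → Fin 3 → ℝ}, ContDiffAt ℝ ∞ a x →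
      ContDiffAt ℝ ∞ b x → ContDiffAt ℝ ∞ c x →
      ContDiffAt ℝ ∞ (fun y => tripleProduct (a y) (b y) (c y)) x := by
    intro a b c ha hb hc
    rw [contDiffAt_pi] at ha hb hc
    have ha0 := ha 0; have ha1 := ha 1; have ha2 := ha 2
    have hb0 := hb 0; have hb1 := hb 1; have hb2 := hb 2
    have hc0 := hc 0; have hc1 := hc 1; have hc2 := hc 2
    unfold tripleProduct
    fun_prop
  have hcov : ∀ u, ContDiffAt ℝ ∞
      (fun y => paramCov κ τ (inChart p φ) (inChart p (frameNormal κ τ φ N)) y u) x := by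
    intro u
    have ha := contDiffAt_pi.mp (hcof u)
    have hd := contDiffAt_pi.mp (hdn u)
    have hn' := contDiffAt_pi.mp hn
    have hφ' := contDiffAt_pi.mp hφx
    have ha0 := ha 0; have ha1 := ha 1; have ha2 := ha 2
    have hd0 := hd 0; have hd1 := hd 1; have hd2 := hd 2
    have hn0 := hn' 0; have hn1 := hn' 1; have hn2 := hn' 2
    have hp0 := hφ' 0; have hp1 := hφ' 1
    rw [contDiffAt_pi]
    intro i
    fin_cases i <;> simp [paramCov, frameCov, rotationForm] <;> fun_prop
  have hden := htp (hcof v) (hcof w) hn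
  have hne : tripleProduct (coframe κ τ (inChart p φ) x v) (coframe κ τ (inChart p φ) x w)
      (inChart p (frameNormal κ τ φ N) x) ≠ 0 := by
    have hv' : coframe κ τ (inChart p φ) x v = b := hv
    have hw' : coframe κ τ (inChart p φ) x w = c := hw
    rw [hv', hw']; exact hbc
  refine ContDiffAt.congr_of_eventuallyEq
    ((((htp (hcov v) (hcof w) hn).neg.sub (htp (hcof v) (hcov w) hn))).div hden hne) ?_
  filter_upwards [hU, hden.continuousAt.eventually_ne hne] with y hy hy0
  rw [Pi.div_apply, eq_div_iff hy0]
  exact trace_inChart hM hy v w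

/-- The charts of a biconservative surface are biconservative parametrizations. -/
theorem isBiconservativeParam_inChart (hM : IsOrientedSurface κ τ φ N)
    (hb : IsBiconservative κ τ φ N) (p : M) :
    IsBiconservativeParam κ τ (chartDomain p) (inChart p φ) (inChart p (frameNormal κ τ φ N))
      (inChart p (meanCurvature κ τ φ N)) where
  isOpen := isOpen_chartDomain p
  smooth := contDiffOn_inChart hM.smooth p
  smooth_normal := contDiffOn_frameNormal hM p
  smooth_curvature := contDiffOn_meanCurvature hM p
  F_pos _ _ := hM.mem_space _
  injective _ hx := coframe_inChart_injective hM hx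
  unit _ _ := frameNormal_dotProduct_self hM _
  orthogonal _ hx v := normal_dotProduct_coframe hM hx v
  trace _ hx v w := trace_inChart hM hx v w
  biconservative x hx := by
    obtain ⟨G, hG⟩ := hb.exists_grad hM ((extChartAt (𝓡 2) p).symm x)
    obtain ⟨v, rfl⟩ := (chartTangent_bijective hx).2 G
    refine ⟨v, fun w => ?_⟩
    have hf := ((contDiffOn_meanCurvature hM p).contDiffAt
      ((isOpen_chartDomain p).mem_nhds hx)).differentiableAt (by simp)
    rw [coframe_inChart hM hx, coframe_inChart hM hx, paramCov_inChart hM hx,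
      fderiv_inChart_real hf hx]
    exact hG (chartTangent p x w)

end Transfer

/-! ### Constant angle and constant mean curvature on a connected surface -/

section Connected

variable {M : Type*} [TopologicalSpace M] [ChartedSpace (EuclideanSpace ℝ (Fin 2)) M]

theorem inChart_extChartAt {X : Type*} (u : M → X) {p q : M}
    (hq : q ∈ (extChartAt (𝓡 2) p).source) : inChart p u (extChartAt (𝓡 2) p q) = u q := by
  rw [inChart, (extChartAt (𝓡 2) p).left_inv hq]

theorem continuous_of_inChart {X : Type*} [TopologicalSpace X] {u : M → X}
    (hu : ∀ p, ContinuousOn (inChart p u) (chartDomain p)) : Continuous u := by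
  rw [continuous_iff_continuousAt]
  intro p
  have h1 : ContinuousAt (inChart p u) (extChartAt (𝓡 2) p p) :=
    (hu p).continuousAt ((isOpen_chartDomain p).mem_nhds (mem_extChartAt_target p))
  refine (ContinuousAt.comp h1 (continuousAt_extChartAt p)).congr ?_
  filter_upwards [extChartAt_source_mem_nhds (I := 𝓡 2) p] with q hq
  exact inChart_extChartAt u hq

theorem exists_eq_const_of_fderiv_eq_zero [ConnectedSpace M] {u : M → ℝ}
    (hd : ∀ p, DifferentiableOn ℝ (inChart p u) (chartDomain p))
    (h0 : ∀ p, ∀ x ∈ chartDomain p, fderiv ℝ (inChart p u) x = 0) : ∃ c, ∀ p, u p = c := by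
  have hloc : IsLocallyConstant u := by
    rw [IsLocallyConstant.iff_eventually_eq]
    intro p
    have hp : extChartAt (𝓡 2) p p ∈ chartDomain p := mem_extChartAt_target p
    obtain ⟨r, hr, hball⟩ := Metric.isOpen_iff.mp (isOpen_chartDomain p) _ hp
    filter_upwards [extChartAt_source_mem_nhds (I := 𝓡 2) p,
      (continuousAt_extChartAt (I := 𝓡 2) p).preimage_mem_nhds (Metric.ball_mem_nhds _ hr)] with q hq hqr
    rw [← inChart_extChartAt u hq, ← inChart_extChartAt u (mem_extChartAt_source (I := 𝓡 2) p)]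
    exact Metric.isOpen_ball.is_const_of_fderiv_eq_zero
      (convex_ball _ _).isPreconnected ((hd p).mono hball) (fun x hx => h0 p x (hball hx))
      hqr (Metric.mem_ball_self hr)
  obtain ⟨c, hc⟩ := hloc.exists_eq_const
  exact ⟨c, fun p => congrFun hc p⟩

theorem exists_eq_const_of_hasDerivAt_zero [ConnectedSpace M] {u : M → ℝ}
    (hd : ∀ p, DifferentiableOn ℝ (inChart p u) (chartDomain p))
    (h0 : ∀ p, ∀ x ∈ chartDomain p, ∀ v,
      HasDerivAt (fun t : ℝ => inChart p u (x + t • v)) 0 0) : ∃ c, ∀ p, u p = c := by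
  refine exists_eq_const_of_fderiv_eq_zero hd fun p x hx => ?_
  ext v
  exact (hasDerivAt_line ((hd p).differentiableAt ((isOpen_chartDomain p).mem_nhds hx)) v).unique
    (h0 p x hx v)

theorem exists_eq_const_of_finite {X : Type*} [TopologicalSpace X] [ConnectedSpace X] {u : X → ℝ}
    (hu : Continuous u) {s : Set ℝ} (hs : s.Finite) (hus : ∀ p, u p ∈ s) : ∃ c, ∀ p, u p = c := by
  obtain ⟨p₀⟩ : Nonempty X := inferInstance
  refine ⟨u p₀, fun p => ?_⟩
  by_contra hne
  exact (isPreconnected_range hu).infinite_of_nontrivial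
    ⟨u p, ⟨p, rfl⟩, u p₀, ⟨p₀, rfl⟩, hne⟩ (hs.subset (by rintro _ ⟨q, rfl⟩; exact hus q))

theorem finite_roots {P : Polynomial ℝ} {k : ℕ} (hP : P.coeff k ≠ 0) :
    {t | P.eval t = 0}.Finite := by
  have h0 : P ≠ 0 := by rintro rfl; simp at hP
  exact Polynomial.finite_setOfPred_isRoot h0

end Connected

section Equivalence

open Polynomial in
theorem finite_quartic_roots (b c : ℝ) : {t : ℝ | 3 * t ^ 4 + b * t ^ 2 + c = 0}.Finite := by
  have := finite_roots (P := C 3 * X ^ 4 + C b * X ^ 2 + C c) (k := 4) (by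
    simp [coeff_X_pow])
  simpa using this

open Polynomial in
theorem finite_cubic_roots (b c : ℝ) : {t : ℝ | t ^ 3 + b * t = c}.Finite := by
  have := finite_roots (P := X ^ 3 + C b * X - C c) (k := 3) (by
    simp [coeff_X_pow])
  simpa [sub_eq_zero] using this

theorem angle_eq {κ τ : ℝ} {M : Type*} {φ N : M → Fin 3 → ℝ} (p : M) :
    angle κ τ φ N p = Real.arccos (frameNormal κ τ φ N p 2) := by
  rw [angle, inner_hopfField]; rfl

variable {κ τ : ℝ} {M : Type*} [TopologicalSpace M]
  [ChartedSpace (EuclideanSpace ℝ (Fin 2)) M] {φ N : M → Fin 3 → ℝ}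

theorem finrank_parameterPlane : Module.finrank ℝ (EuclideanSpace ℝ (Fin 2)) = 2 := by simp

theorem continuous_meanCurvature [IsManifold (𝓡 2) ∞ M]
    (hM : IsOrientedSurface κ τ φ N) :
    Continuous (meanCurvature κ τ φ N) :=
  continuous_of_inChart fun p => (contDiffOn_meanCurvature hM p).continuousOn

theorem continuous_frameNormal [IsManifold (𝓡 2) ∞ M]
    (hM : IsOrientedSurface κ τ φ N) :
    Continuous (frameNormal κ τ φ N) :=
  continuous_of_inChart fun p => (contDiffOn_frameNormal hM p).continuousOn

theorem sum_frameNormal (hM : IsOrientedSurface κ τ φ N) (p : M) :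
    frameNormal κ τ φ N p 0 ^ 2 + frameNormal κ τ φ N p 1 ^ 2 + frameNormal κ τ φ N p 2 ^ 2 = 1 := by
  have h := frameNormal_dotProduct_self hM p
  simp only [dotProduct, Fin.sum_univ_three] at h
  simp only [frameNormal]
  linear_combination h

theorem isMinimal_of_vertical [IsManifold (𝓡 2) ∞ M]
    (hM : IsOrientedSurface κ τ φ N) (hb : IsBiconservative κ τ φ N)
    (h0 : ∀ p, frameNormal κ τ φ N p 0 = 0 ∧ frameNormal κ τ φ N p 1 = 0) :
    IsMinimal κ τ φ N := by
  intro p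
  rw [← inChart_extChartAt (meanCurvature κ τ φ N) (mem_extChartAt_source (I := 𝓡 2) p)]
  exact (isBiconservativeParam_inChart hM hb p).curvature_eq_zero_of_vertical
    finrank_parameterPlane (fun _ _ => h0 _) (mem_extChartAt_target p)

theorem isCMC_of_isConstantAngle [ConnectedSpace M] [IsManifold (𝓡 2) ∞ M]
    (hM : IsOrientedSurface κ τ φ N)
    (hb : IsBiconservative κ τ φ N) (hmin : ¬ IsMinimal κ τ φ N)
    (ha : IsConstantAngle κ τ φ N) : IsCMC κ τ φ N := by
  obtain ⟨p₀⟩ : Nonempty M := inferInstance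
  obtain ⟨ν, hν⟩ : ∃ ν, ∀ p, frameNormal κ τ φ N p 2 = ν := by
    obtain ⟨α, hα⟩ := ha
    refine ⟨frameNormal κ τ φ N p₀ 2, fun p => ?_⟩
    have hI : ∀ p, frameNormal κ τ φ N p 2 ∈ Set.Icc (-1 : ℝ) 1 := by
      intro p
      rw [Set.mem_Icc, ← abs_le, ← sq_le_one_iff_abs_le_one]
      have := sum_frameNormal hM p
      nlinarith [sq_nonneg (frameNormal κ τ φ N p 0), sq_nonneg (frameNormal κ τ φ N p 1)]
    apply Real.arccos_injOn (hI p) (hI p₀)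
    rw [← angle_eq, ← angle_eq, hα, hα]
  have hparam := isBiconservativeParam_inChart hM hb
  have hpar : ∀ p, inChart p (meanCurvature κ τ φ N) (extChartAt (𝓡 2) p p)
      = meanCurvature κ τ φ N p := fun p =>
    inChart_extChartAt (meanCurvature κ τ φ N) (mem_extChartAt_source (I := 𝓡 2) p)
  by_cases h0 : ν = 0
  · -- here `f³ - 4τ² f` is locally constant, so that `f` takes finitely many values
    subst h0
    obtain ⟨c, hc⟩ := exists_eq_const_of_fderiv_eq_zero
      (u := fun p => meanCurvature κ τ φ N p ^ 3 + (-4 * τ ^ 2) * meanCurvature κ τ φ N p)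
      (fun p => (((contDiffOn_meanCurvature hM p).differentiableOn (by simp)).fun_pow 3).fun_add
        (((contDiffOn_meanCurvature hM p).differentiableOn (by simp)).const_mul _))
      (fun p x hx => by
        have hf := (hparam p).differentiableAt_curvature hx
        have h1 := (hparam p).smul_fderiv_curvature_of_angle_right finrank_parameterPlane
          (fun _ _ => hν _) hx
        have h2 := ((hasDerivAt_pow 3 _).fun_add
          ((hasDerivAt_id' _).const_mul (-4 * τ ^ 2))).comp_hasFDerivAt x hf.hasFDerivAt
        refine h2.fderiv.trans ?_
        rw [← h1]
        congr 1
        push_cast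
        ring)
    exact exists_eq_const_of_finite (continuous_meanCurvature hM)
      (finite_cubic_roots (-4 * τ ^ 2) c) hc
  by_cases h1 : 1 - ν ^ 2 = 0
  · refine absurd (isMinimal_of_vertical hM hb fun p => ?_) hmin
    have := sum_frameNormal hM p
    rw [hν p] at this
    constructor <;>
      nlinarith [sq_nonneg (frameNormal κ τ φ N p 0), sq_nonneg (frameNormal κ τ φ N p 1)]
  refine exists_eq_const_of_finite (continuous_meanCurvature hM)
    (finite_quartic_roots (-(4 * τ ^ 2) + 3 * (κ * (1 - ν ^ 2) + 4 * τ ^ 2 * ν ^ 2)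
        + 6 * (1 - ν ^ 2) * (4 * τ ^ 2 - κ))
      (-(4 * τ ^ 2 * (κ * (1 - ν ^ 2) + 4 * τ ^ 2 * ν ^ 2)))) fun p => ?_
  have := (hparam p).curvature_polynomial_of_angle_oblique finrank_parameterPlane
    (fun _ _ => hν _) h0 h1 (mem_extChartAt_target p)
  rw [hpar] at this
  simp only [Set.mem_ofPred_eq]
  linear_combination this

theorem horizontal_of_isCMC [ConnectedSpace M] [IsManifold (𝓡 2) ∞ M]
    (hκτ : κ ≠ 4 * τ ^ 2) (hM : IsOrientedSurface κ τ φ N)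
    (hb : IsBiconservative κ τ φ N) (hmin : ¬ IsMinimal κ τ φ N)
    (hc : IsCMC κ τ φ N) (p : M) : frameNormal κ τ φ N p 2 = 0 := by
  obtain ⟨c, hc⟩ := hc
  have hc0 : c ≠ 0 := by
    rintro rfl
    exact hmin hc
  have hdich : ∀ p, frameNormal κ τ φ N p 2 = 0 ∨
      frameNormal κ τ φ N p 0 = 0 ∧ frameNormal κ τ φ N p 1 = 0 := by
    intro p
    have := (isBiconservativeParam_inChart hM hb p).vertical_or_horizontal
      finrank_parameterPlane hκτ hc0 (fun _ _ => hc _) (mem_extChartAt_target p)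
    rwa [inChart_extChartAt (frameNormal κ τ φ N) (mem_extChartAt_source (I := 𝓡 2) p)] at this
  have hsum := sum_frameNormal hM
  obtain ⟨ν, hν⟩ := exists_eq_const_of_finite (s := {0, 1})
    (u := fun p => frameNormal κ τ φ N p 2 ^ 2)
    (((continuous_apply 2).comp (continuous_frameNormal hM)).pow 2) (Set.toFinite _) (fun p => by
      rcases hdich p with h | ⟨h, h'⟩
      · simp [h]
      · have := hsum p
        simp only [h, h'] at this
        right
        simp only [Set.mem_singleton_iff]
        linear_combination this)
  rcases hdich p with h | ⟨h, h'⟩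
  · exact h
  -- otherwise the normal is vertical everywhere
  have h1 : ν = 1 := by
    have := hsum p
    simp only [h, h'] at this
    rw [← hν p]
    linear_combination this
  refine absurd (isMinimal_of_vertical hM hb fun q => ?_) hmin
  rcases hdich q with hq | hq
  · have := hν q
    simp [hq, h1] at this
  · exact hq

end Equivalence

/-! ### The base curve of a surface with horizontal normal -/

section BaseCurve

variable {κ τ : ℝ} {M : Type*} [TopologicalSpace M]
  [ChartedSpace (EuclideanSpace ℝ (Fin 2)) M] [IsManifold (𝓡 2) ∞ M] {φ N : M → Fin 3 → ℝ}

variable (κ τ φ N) in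
/-- The curvature in the Euclidean plane, up to sign, of the projection to the base of a surface
with horizontal normal and mean curvature `h`. -/
def euclideanCurvature (h : ℝ) (p : M) : ℝ :=
  (h - κ / 2 * (frameNormal κ τ φ N p 0 * φ p 0 + frameNormal κ τ φ N p 1 * φ p 1))
    * (F κ (φ p 0) (φ p 1))⁻¹

/-- A surface with horizontal normal and constant mean curvature lies over a circle or a straight
line of the Euclidean plane: its Gauss map composed with the projection to the base is affine in
the position. -/
theorem exists_curve_equation [ConnectedSpace M] (hM : IsOrientedSurface κ τ φ N)
    (hb : IsBiconservative κ τ φ N) (hh : ∀ p, frameNormal κ τ φ N p 2 = 0)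
    {h : ℝ} (hf : ∀ p, meanCurvature κ τ φ N p = h) :
    ∃ k c₀ c₁ d : ℝ, ∀ p, frameNormal κ τ φ N p 0 = c₀ - k * φ p 0 ∧
      frameNormal κ τ φ N p 1 = c₁ - k * φ p 1 ∧
      c₀ * φ p 0 + c₁ * φ p 1 - k / 2 * (φ p 0 ^ 2 + φ p 1 ^ 2) = d := by
  have hparam := isBiconservativeParam_inChart hM hb
  have hF : ∀ p, ∀ x ∈ chartDomain p, F κ (inChart p φ x 0) (inChart p φ x 1) ≠ 0 :=
    fun p x hx => ((hparam p).F_pos x hx).ne'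
  -- the derivative of the normal
  have key : ∀ p, ∀ x ∈ chartDomain p, ∀ v,
      fderiv ℝ (inChart p (frameNormal κ τ φ N)) x v 0
        = -inChart p (euclideanCurvature κ τ φ N h) x * fderiv ℝ (inChart p φ) x v 0 ∧
      fderiv ℝ (inChart p (frameNormal κ τ φ N)) x v 1
        = -inChart p (euclideanCurvature κ τ φ N h) x * fderiv ℝ (inChart p φ) x v 1 := by
    intro p x hx v
    have h1 := (hparam p).fderiv_normal_of_horizontal finrank_parameterPlane
      (fun _ _ => hh _) hx v
    have hfx : inChart p (meanCurvature κ τ φ N) x = h := hf _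
    rw [hfx] at h1
    have hF' := hF p x hx
    have hk : inChart p (euclideanCurvature κ τ φ N h) x =
      (h - κ / 2 * (inChart p (frameNormal κ τ φ N) x 0 * inChart p φ x 0
        + inChart p (frameNormal κ τ φ N) x 1 * inChart p φ x 1))
        * (F κ (inChart p φ x 0) (inChart p φ x 1))⁻¹ := rfl
    rw [hk]
    constructor <;> apply mul_left_cancel₀ hF'
    · rw [h1.1]; field_simp
    · rw [h1.2]; field_simp
  have horth : ∀ p, ∀ x ∈ chartDomain p, ∀ v,
      inChart p (frameNormal κ τ φ N) x 0 * fderiv ℝ (inChart p φ) x v 0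
        + inChart p (frameNormal κ τ φ N) x 1 * fderiv ℝ (inChart p φ) x v 1 = 0 := by
    intro p x hx v
    have h1 := (hparam p).sum_orthogonal hx v
    have h2 : inChart p (frameNormal κ τ φ N) x 2 = 0 := hh _
    rw [h2] at h1
    simp only [coframe, ContinuousLinearMap.comp_apply, frameCoord_zero, frameCoord_one] at h1
    apply mul_left_cancel₀ (inv_ne_zero (hF p x hx))
    linear_combination h1
  have hn' : ∀ p, ∀ x ∈ chartDomain p, ∀ i v, HasDerivAt
      (fun t : ℝ => inChart p (frameNormal κ τ φ N) (x + t • v) i)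
      (fderiv ℝ (inChart p (frameNormal κ τ φ N)) x v i) 0 :=
    fun p x hx i v => (hparam p).hasDerivAt_normal hx v i
  have hφ' : ∀ p, ∀ x ∈ chartDomain p, ∀ i v, HasDerivAt
      (fun t : ℝ => inChart p φ (x + t • v) i) (fderiv ℝ (inChart p φ) x v i) 0 :=
    fun p x hx i v => (hasDerivAt_pi.mp (hasDerivAt_line ((hparam p).differentiableAt hx) v)) i
  have dn : ∀ p i, DifferentiableOn ℝ (fun y => inChart p (frameNormal κ τ φ N) y i)
      (chartDomain p) := fun p i =>
    (contDiffOn_pi.mp (contDiffOn_frameNormal hM p) i).differentiableOn (by simp)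
  have dφ : ∀ p i, DifferentiableOn ℝ (fun y => inChart p φ y i) (chartDomain p) := fun p i =>
    (contDiffOn_pi.mp (contDiffOn_inChart hM.smooth p) i).differentiableOn (by simp)
  obtain ⟨k, hk⟩ : ∃ k, ∀ p, euclideanCurvature κ τ φ N h p = k := by
    refine exists_eq_const_of_hasDerivAt_zero (fun p => ?_) fun p x hx v => ?_
    · have dF : DifferentiableOn ℝ (fun y => (F κ (inChart p φ y 0) (inChart p φ y 1))⁻¹)
          (chartDomain p) := by
        refine DifferentiableOn.inv ?_ (hF p)
        exact ((((dφ p 0).fun_pow 2).fun_add ((dφ p 1).fun_pow 2)).const_mul (κ / 4)).const_add 1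
      exact ((((dn p 0).fun_mul (dφ p 0)).fun_add ((dn p 1).fun_mul (dφ p 1))).const_mul
        (κ / 2)).const_sub h |>.fun_mul dF
    · have hF' := hF p x hx
      have dF := ((((hφ' p x hx 0 v).fun_pow 2).fun_add ((hφ' p x hx 1 v).fun_pow 2)).const_mul
        (κ / 4)).const_add 1
      have dG := dF.fun_inv (by simpa [F] using hF')
      have dk := ((((hn' p x hx 0 v).fun_mul (hφ' p x hx 0 v)).fun_add
        ((hn' p x hx 1 v).fun_mul (hφ' p x hx 1 v))).const_mul (κ / 2)).const_sub h |>.fun_mul dG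
      refine dk.congr_deriv ?_
      simp only [zero_smul, add_zero, (key p x hx v).1, (key p x hx v).2]
      have hnum : h - κ / 2 * (inChart p (frameNormal κ τ φ N) x 0 * inChart p φ x 0
          + inChart p (frameNormal κ τ φ N) x 1 * inChart p φ x 1)
          = inChart p (euclideanCurvature κ τ φ N h) x
            * F κ (inChart p φ x 0) (inChart p φ x 1) := by
        simp only [inChart] at hF'
        simp only [euclideanCurvature, inChart]
        field_simp
      have ho := horth p x hx v
      rw [hnum]
      simp only [F] at hF' ⊢
      generalize 1 + κ / 4 * (inChart p φ x 0 ^ 2 + inChart p φ x 1 ^ 2) = G at hF'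
      field_simp
      push_cast
      linear_combination (-4 * κ) * ho
  have hconst : ∀ i : Fin 3, i = 0 ∨ i = 1 → ∃ c, ∀ p, frameNormal κ τ φ N p i + k * φ p i = c := by
    intro i hi
    refine exists_eq_const_of_hasDerivAt_zero (fun p => (dn p i).fun_add ((dφ p i).const_mul k))
      fun p x hx v => ?_
    refine ((hn' p x hx i v).fun_add ((hφ' p x hx i v).const_mul k)).congr_deriv ?_
    have hkx : inChart p (euclideanCurvature κ τ φ N h) x = k := hk _
    rcases hi with rfl | rfl
    · rw [(key p x hx v).1, hkx]; ring
    · rw [(key p x hx v).2, hkx]; ring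
  obtain ⟨c₀, hc₀⟩ := hconst 0 (Or.inl rfl)
  obtain ⟨c₁, hc₁⟩ := hconst 1 (Or.inr rfl)
  obtain ⟨d, hd⟩ : ∃ d, ∀ p,
      c₀ * φ p 0 + c₁ * φ p 1 - k / 2 * (φ p 0 ^ 2 + φ p 1 ^ 2) = d := by
    refine exists_eq_const_of_hasDerivAt_zero (fun p =>
      (((dφ p 0).const_mul c₀).fun_add ((dφ p 1).const_mul c₁)).fun_sub
        ((((dφ p 0).fun_pow 2).fun_add ((dφ p 1).fun_pow 2)).const_mul (k / 2))) fun p x hx v => ?_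
    refine ((((hφ' p x hx 0 v).const_mul c₀).fun_add ((hφ' p x hx 1 v).const_mul c₁)).fun_sub
      ((((hφ' p x hx 0 v).fun_pow 2).fun_add ((hφ' p x hx 1 v).fun_pow 2)).const_mul
        (k / 2))).congr_deriv ?_
    have ho := horth p x hx v
    have h0 : inChart p (frameNormal κ τ φ N) x 0 + k * inChart p φ x 0 = c₀ := hc₀ _
    have h1 : inChart p (frameNormal κ τ φ N) x 1 + k * inChart p φ x 1 = c₁ := hc₁ _
    simp only [zero_smul, add_zero]
    push_cast
    linear_combination ho - fderiv ℝ (inChart p φ) x v 0 * h0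
      - fderiv ℝ (inChart p φ) x v 1 * h1
  exact ⟨k, c₀, c₁, d, fun p => ⟨by rw [← hc₀ p]; ring, by rw [← hc₁ p]; ring, hd p⟩⟩

end BaseCurve

/-! ### Curves of constant geodesic curvature in the base -/

section BaseMetric

variable {κ : ℝ}

theorem hasGrad_base_F (q : Fin 2 → ℝ) :
    HasGrad (fun q : Fin 2 → ℝ => F κ (q 0) (q 1)) (fun l => κ / 2 * q l) q := by
  have h := (hasGrad_const (q := q) 1).add (HasGrad.const_mul (κ / 4)
    (((hasGrad_coord 0).mul (hasGrad_coord 0)).add ((hasGrad_coord 1).mul (hasGrad_coord 1))))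
  have h2 : (fun q : Fin 2 → ℝ => F κ (q 0) (q 1)) =
      fun q => 1 + κ / 4 * (q 0 * q 0 + q 1 * q 1) := by
    funext q; simp only [F]; ring
  rw [h2]
  refine h.congr_grad ?_
  funext i
  fin_cases i <;> simp <;> ring

theorem hasGrad_baseMetric (i j : Fin 2) {q : Fin 2 → ℝ} (hq : F κ (q 0) (q 1) ≠ 0) :
    HasGrad (fun q => baseMetric κ q i j)
      (fun l => if i = j then -(κ * q l) / F κ (q 0) (q 1) ^ 3 else 0) q := by
  have hF := (hasGrad_base_F (κ := κ) q).inv hq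
  by_cases hij : i = j
  · have hfun : (fun q => baseMetric κ q i j) =
        fun q : Fin 2 → ℝ => (F κ (q 0) (q 1))⁻¹ * (F κ (q 0) (q 1))⁻¹ := by
      funext q
      subst hij
      fin_cases i <;> simp [baseMetric] <;> ring
    rw [hfun]
    refine (hF.mul hF).congr_grad ?_
    funext l
    rw [if_pos hij]
    field_simp
    ring
  · have hfun : (fun q => baseMetric κ q i j) = fun q : Fin 2 → ℝ => 0 := by
      funext q
      simp [baseMetric, hij]
    rw [hfun]
    simpa [hij] using hasGrad_const (q := q) 0

theorem connectionTerm_baseMetric {q : Fin 2 → ℝ} (hq : F κ (q 0) (q 1) ≠ 0) (v : Fin 2 → ℝ) :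
    connectionTerm (baseMetric κ) q v v = fun l =>
      (-κ * (q 0 * v 0 + q 1 * v 1) * v l + κ / 2 * (v 0 ^ 2 + v 1 ^ 2) * q l)
        / F κ (q 0) (q 1) := by
  have hinv : (baseMetric κ q)⁻¹ = Matrix.diagonal fun _ => F κ (q 0) (q 1) ^ 2 := by
    apply Matrix.inv_eq_right_inv
    ext i j
    fin_cases i <;> fin_cases j <;> simp [baseMetric, hq]
  funext l
  simp only [connectionTerm, christoffel, (hasGrad_baseMetric _ _ hq).partialDeriv_eq, hinv,
    Fin.sum_univ_two]
  fin_cases l <;> simp <;> field_simp <;> ring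

theorem geodesicCurvature_eq {γ : ℝ → Fin 2 → ℝ} {s : ℝ}
    (hq : F κ (γ s 0) (γ s 1) ≠ 0) :
    geodesicCurvature κ γ s = (deriv γ s 0 * deriv (deriv γ) s 1
        - deriv γ s 1 * deriv (deriv γ) s 0) / F κ (γ s 0) (γ s 1) ^ 2
      + κ / 2 * (deriv γ s 0 ^ 2 + deriv γ s 1 ^ 2) * (deriv γ s 0 * γ s 1 - deriv γ s 1 * γ s 0)
        / F κ (γ s 0) (γ s 1) ^ 3 := by
  rw [geodesicCurvature, connectionTerm_baseMetric hq]
  simp [inner, baseMetric, dotProduct, Fin.sum_univ_two, Matrix.mulVec_diagonal]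
  field_simp
  ring

end BaseMetric

section Reparametrization

/-- A circle or straight line of the Euclidean plane, parametrized by Euclidean arc length and
restricted to an interval on which it stays in the base, has constant geodesic curvature in the base
after reparametrization by arc length of the base metric. -/
theorem exists_unitSpeed_reparametrization {κ k : ℝ} {e₀ e₁ a b : ℝ → ℝ} {J : Set ℝ} {t₀ : ℝ}
    (he₀ : ∀ t, HasDerivAt e₀ (a t) t) (he₁ : ∀ t, HasDerivAt e₁ (b t) t)
    (ha : ∀ t, HasDerivAt a (-(k * b t)) t) (hb : ∀ t, HasDerivAt b (k * a t) t)
    (hab : ∀ t, a t ^ 2 + b t ^ 2 = 1) (hs₀ : ContDiff ℝ ∞ e₀) (hs₁ : ContDiff ℝ ∞ e₁)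
    (hJ : IsOpen J) (hJc : J.OrdConnected) (ht₀ : t₀ ∈ J) (hF : ∀ t ∈ J, 0 < F κ (e₀ t) (e₁ t)) :
    ∃ (I : Set ℝ) (γ : ℝ → Fin 2 → ℝ), IsUnitSpeedCurve κ I γ ∧
      (∃ c : ℝ, ∀ s ∈ I, geodesicCurvature κ γ s = c) ∧
      γ '' I = (fun t => ![e₀ t, e₁ t]) '' J := by
  set G : ℝ → ℝ := fun t => F κ (e₀ t) (e₁ t) with hG
  have hGs : ContDiff ℝ ∞ G := by
    simp only [hG, F]; fun_prop
  have hGd : ∀ t, HasDerivAt G (κ / 2 * (e₀ t * a t + e₁ t * b t)) t := by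
    intro t
    have h := ((((he₀ t).fun_pow 2).fun_add ((he₁ t).fun_pow 2)).const_mul (κ / 4)).const_add 1
    refine h.congr_deriv ?_
    push_cast
    ring
  -- the arc length and its inverse
  set s : ℝ → ℝ := fun t => ∫ r in t₀..t, (G r)⁻¹ with hs
  have hcont : ContinuousOn (fun r => (G r)⁻¹) J :=
    hGs.continuous.continuousOn.inv₀ fun t ht => (hF t ht).ne'
  have hsd : ∀ t ∈ J, HasStrictDerivAt s (G t)⁻¹ t := by
    intro t ht
    refine intervalIntegral.integral_hasStrictDerivAt_right ?_ ?_ ?_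
    · exact (hcont.mono (hJc.uIcc_subset ht₀ ht)).intervalIntegrable
    · exact hcont.stronglyMeasurableAtFilter hJ _ ht
    · exact hcont.continuousAt (hJ.mem_nhds ht)
  have hmono : StrictMonoOn s J := by
    refine strictMonoOn_of_deriv_pos hJc.convex
      (fun t ht => (hsd t ht).hasDerivAt.continuousAt.continuousWithinAt) fun t ht => ?_
    rw [(hsd t (interior_subset ht)).hasDerivAt.deriv]
    exact inv_pos.mpr (hF t (interior_subset ht))
  set I := s '' J with hI
  have hIo : IsOpen I := by
    rw [isOpen_iff_mem_nhds]
    rintro _ ⟨t, ht, rfl⟩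
    rw [← (hsd t ht).map_nhds_eq (inv_ne_zero (hF t ht).ne')]
    exact Filter.image_mem_map (hJ.mem_nhds ht)
  set σ := Function.invFunOn s J with hσ
  have hσs : ∀ t ∈ J, σ (s t) = t := fun t ht => hmono.injOn.leftInvOn_invFunOn ht
  have hσJ : ∀ y ∈ I, σ y ∈ J := by
    rintro _ ⟨t, ht, rfl⟩; rw [hσs t ht]; exact ht
  have hsσ : ∀ y ∈ I, s (σ y) = y := by
    rintro _ ⟨t, ht, rfl⟩; rw [hσs t ht]
  have hσI : σ '' I = J := by
    ext t
    constructor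
    · rintro ⟨y, hy, rfl⟩; exact hσJ y hy
    · intro ht; exact ⟨s t, ⟨t, ht, rfl⟩, hσs t ht⟩
  have hσmono : StrictMonoOn σ I := by
    rintro _ ⟨t, ht, rfl⟩ _ ⟨r, hr, rfl⟩ hlt
    rw [hσs t ht, hσs r hr]
    exact (hmono.lt_iff_lt ht hr).mp hlt
  have hσd : ∀ y ∈ I, HasDerivAt σ (G (σ y)) y := by
    intro y hy
    have hc : ContinuousAt σ y := hσmono.continuousAt_of_image_mem_nhds (hIo.mem_nhds hy) (by
      rw [hσI]; exact hJ.mem_nhds (hσJ y hy))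
    have h := HasDerivAt.of_local_left_inverse hc (hsd _ (hσJ y hy)).hasDerivAt
      (inv_ne_zero (hF _ (hσJ y hy)).ne') (by
        filter_upwards [hIo.mem_nhds hy] with z hz using hsσ z hz)
    simpa using h
  have hσsm : ContDiffOn ℝ ∞ σ I := by
    rw [contDiffOn_infty]
    intro m
    induction m with
    | zero => exact contDiffOn_zero.mpr fun y hy => (hσd y hy).continuousAt.continuousWithinAt
    | succ m ih =>
      push_cast
      rw [contDiffOn_succ_iff_deriv_of_isOpen hIo]
      refine ⟨fun y hy => (hσd y hy).differentiableAt.differentiableWithinAt, by simp, ?_⟩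
      refine ((hGs.of_le (by exact_mod_cast le_top)).comp_contDiffOn ih).congr fun y hy => ?_
      exact (hσd y hy).deriv
  -- the reparametrized curve
  set γ : ℝ → Fin 2 → ℝ := fun y => ![e₀ (σ y), e₁ (σ y)] with hγ
  have hγd : ∀ y ∈ I, HasDerivAt γ ![a (σ y) * G (σ y), b (σ y) * G (σ y)] y := by
    intro y hy
    rw [hasDerivAt_pi]
    intro i
    fin_cases i
    · exact (he₀ _).comp y (hσd y hy)
    · exact (he₁ _).comp y (hσd y hy)
  have hγdd : ∀ y ∈ I, HasDerivAt (deriv γ)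
      ![(-(k * b (σ y)) * G (σ y)) * G (σ y)
          + a (σ y) * (κ / 2 * (e₀ (σ y) * a (σ y) + e₁ (σ y) * b (σ y)) * G (σ y)),
        (k * a (σ y) * G (σ y)) * G (σ y)
          + b (σ y) * (κ / 2 * (e₀ (σ y) * a (σ y) + e₁ (σ y) * b (σ y)) * G (σ y))] y := by
    intro y hy
    have hev : deriv γ =ᶠ[nhds y] fun y => ![a (σ y) * G (σ y), b (σ y) * G (σ y)] := by
      filter_upwards [hIo.mem_nhds hy] with z hz using (hγd z hz).deriv
    refine HasDerivAt.congr_of_eventuallyEq ?_ hev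
    rw [hasDerivAt_pi]
    intro i
    fin_cases i
    · exact ((ha _).comp y (hσd y hy)).fun_mul ((hGd _).comp y (hσd y hy))
    · exact ((hb _).comp y (hσd y hy)).fun_mul ((hGd _).comp y (hσd y hy))
  refine ⟨I, γ, ⟨hIo, ?_, ?_, ?_, ?_⟩, ?_, ?_⟩
  · refine IsPreconnected.ordConnected (hJc.isPreconnected.image _ fun t ht => ?_)
    exact (hsd t ht).hasDerivAt.continuousAt.continuousWithinAt
  · rw [contDiffOn_pi]
    intro i
    fin_cases i
    · exact hs₀.comp_contDiffOn hσsm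
    · exact hs₁.comp_contDiffOn hσsm
  · intro y hy
    exact hF _ (hσJ y hy)
  · intro y hy
    have h1 := (hF _ (hσJ y hy)).ne'
    have h2 : G (σ y) = F κ (e₀ (σ y)) (e₁ (σ y)) := rfl
    have h3 := hab (σ y)
    rw [(hγd y hy).deriv]
    simp [inner, baseMetric, dotProduct, Fin.sum_univ_two, Matrix.mulVec_diagonal, hγ, h2]
    field_simp
    linear_combination h3
  · have hconst : ∀ t, HasDerivAt (fun t => G t * k + κ / 2 * (a t * e₁ t - b t * e₀ t)) 0 t := by
      intro t
      refine (((hGd t).mul_const k).fun_add ((((ha t).fun_mul (he₁ t)).fun_sub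
        ((hb t).fun_mul (he₀ t))).const_mul (κ / 2))).congr_deriv ?_
      ring
    refine ⟨G t₀ * k + κ / 2 * (a t₀ * e₁ t₀ - b t₀ * e₀ t₀), fun y hy => ?_⟩
    have h0 := is_const_of_deriv_eq_zero (fun t => (hconst t).differentiableAt)
      (fun t => (hconst t).deriv) (σ y) t₀
    rw [← h0]
    have h1 := (hF _ (hσJ y hy)).ne'
    rw [geodesicCurvature_eq (κ := κ) (γ := γ) (s := y) h1, (hγd y hy).deriv, (hγdd y hy).deriv]
    have h2 : G (σ y) = F κ (e₀ (σ y)) (e₁ (σ y)) := rfl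
    have h3 := hab (σ y)
    simp only [hγ, Matrix.cons_val, h2]
    generalize F κ (e₀ (σ y)) (e₁ (σ y)) = Φ at h1
    field_simp
    linear_combination (2 * Φ * k + κ * (a (σ y) * e₁ (σ y) - b (σ y) * e₀ (σ y))) * h3
  · rw [hI, Set.image_image]
    exact Set.image_congr fun t ht => by simp only [hγ, hσs t ht]

end Reparametrization

section Conics

/-- The part in the base of the circle or straight line `c·q - (k/2)|q|² = d` of the Euclidean
plane, with the normalization `|c|² - 2kd = 1` under which its Euclidean curvature is `±k`. -/
def baseCircle (κ k c₀ c₁ d : ℝ) : Set (Fin 2 → ℝ) :=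
  {q ∈ base κ | c₀ * q 0 + c₁ * q 1 - k / 2 * (q 0 ^ 2 + q 1 ^ 2) = d}

theorem ordConnected_of_antitone_abs {g : ℝ → ℝ} {R : Set ℝ}
    (hR : ∀ x ∈ R, ∀ z, |z| ≤ |x| → z ∈ R ∧ g x ≤ g z) : {t ∈ R | 0 < g t}.OrdConnected := by
  refine ⟨fun x hx y hy z hz => ?_⟩
  rcases le_max_iff.mp (abs_le_max_abs_abs hz.1 hz.2) with h | h
  · exact ⟨(hR x hx.1 z h).1, hx.2.trans_le (hR x hx.1 z h).2⟩
  · exact ⟨(hR y hy.1 z h).1, hy.2.trans_le (hR y hy.1 z h).2⟩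

theorem exists_unitSpeed_line {κ c₀ c₁ d : ℝ} (hc : c₀ ^ 2 + c₁ ^ 2 = 1)
    (hne : (baseCircle κ 0 c₀ c₁ d).Nonempty) :
    ∃ (I : Set ℝ) (γ : ℝ → Fin 2 → ℝ), IsUnitSpeedCurve κ I γ ∧
      (∃ c : ℝ, ∀ s ∈ I, geodesicCurvature κ γ s = c) ∧ γ '' I = baseCircle κ 0 c₀ c₁ d := by
  have hFe : ∀ t, F κ (d * c₀ - t * c₁) (d * c₁ + t * c₀) = 1 + κ / 4 * (d ^ 2 + t ^ 2) := by
    intro t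
    simp only [F]
    linear_combination κ / 4 * (d ^ 2 + t ^ 2) * hc
  set J : Set ℝ := {t ∈ Set.univ | 0 < F κ (d * c₀ - t * c₁) (d * c₁ + t * c₀)} with hJ
  have himage : (fun t => ![d * c₀ - t * c₁, d * c₁ + t * c₀]) '' J = baseCircle κ 0 c₀ c₁ d := by
    ext q
    constructor
    · rintro ⟨t, ht, rfl⟩
      refine ⟨ht.2, ?_⟩
      simp only [Matrix.cons_val]
      linear_combination d * hc
    · rintro ⟨hq, hqd⟩
      have h0 : d * c₀ - (c₀ * q 1 - c₁ * q 0) * c₁ = q 0 := by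
        linear_combination (-c₀) * hqd + q 0 * hc
      have h1 : d * c₁ + (c₀ * q 1 - c₁ * q 0) * c₀ = q 1 := by
        linear_combination (-c₁) * hqd + q 1 * hc
      refine ⟨c₀ * q 1 - c₁ * q 0, ⟨trivial, ?_⟩, ?_⟩
      · rw [h0, h1]; exact hq
      · simp only [h0, h1]
        ext i
        fin_cases i <;> rfl
  obtain ⟨t₀, ht₀⟩ : J.Nonempty := by
    rw [← himage] at hne
    exact hne.of_image
  rw [← himage]
  refine exists_unitSpeed_reparametrization (k := 0) (a := fun _ => -c₁) (b := fun _ => c₀)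
    (t₀ := t₀) (fun t => ?_) (fun t => ?_) (fun t => ?_) (fun t => ?_) (fun t => ?_) (by fun_prop)
    (by fun_prop) ?_ ?_ ht₀ (fun t ht => ht.2)
  · simpa using ((hasDerivAt_id' t).mul_const c₁).const_sub (d * c₀)
  · simpa using ((hasDerivAt_id' t).mul_const c₀).const_add (d * c₁)
  · simpa using hasDerivAt_const t (-c₁)
  · simpa using hasDerivAt_const t c₀
  · linear_combination hc
  · rw [hJ, Set.sep_univ]
    exact isOpen_lt continuous_const (by unfold F; fun_prop)
  · rcases le_or_gt 0 κ with hκ | hκ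
    · have : J = Set.univ := by
        rw [hJ, Set.sep_univ, Set.eq_univ_iff_forall]
        intro t
        simp only [Set.mem_ofPred_eq, hFe]
        positivity
      rw [this]
      exact Set.ordConnected_univ
    · refine ordConnected_of_antitone_abs fun x _ z hz => ⟨trivial, ?_⟩
      rw [hFe, hFe]
      have := sq_le_sq.mpr hz
      nlinarith

theorem exists_cos_sin {x y : ℝ} (h : x ^ 2 + y ^ 2 = 1) :
    ∃ θ, |θ| ≤ Real.pi ∧ Real.cos θ = x ∧ Real.sin θ = y := by
  have hn : ‖(⟨x, y⟩ : ℂ)‖ = 1 := by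
    rw [Complex.norm_def, Complex.normSq_mk, ← pow_two, ← pow_two, h, Real.sqrt_one]
  have h0 : (⟨x, y⟩ : ℂ) ≠ 0 := by
    intro h'
    rw [h'] at hn
    simp at hn
  refine ⟨Complex.arg ⟨x, y⟩, Complex.abs_arg_le_pi _, ?_, ?_⟩
  · rw [Complex.cos_arg h0, hn, div_one]
  · rw [Complex.sin_arg, hn, div_one]

theorem exists_unitSpeed_circle {κ k c₀ c₁ d : ℝ} (hk : k ≠ 0) (hc : c₀ ^ 2 + c₁ ^ 2 - 2 * k * d = 1)
    (hne : (baseCircle κ k c₀ c₁ d).Nonempty) :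
    ∃ (I : Set ℝ) (γ : ℝ → Fin 2 → ℝ), IsUnitSpeedCurve κ I γ ∧
      (∃ c : ℝ, ∀ s ∈ I, geodesicCurvature κ γ s = c) ∧ γ '' I = baseCircle κ k c₀ c₁ d := by
  -- the parametrization starts from the point of the circle where `F` is largest
  obtain ⟨g₀, g₁, μ, hg, h0, h1, hμ⟩ : ∃ g₀ g₁ μ : ℝ, g₀ ^ 2 + g₁ ^ 2 = 1 ∧ c₀ = μ * g₀ ∧
      c₁ = μ * g₁ ∧ 0 ≤ κ * μ := by
    by_cases hz : c₀ ^ 2 + c₁ ^ 2 = 0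
    · refine ⟨1, 0, 0, by norm_num, ?_, ?_, by simp⟩ <;> nlinarith [sq_nonneg c₀, sq_nonneg c₁]
    · have hpos : 0 < c₀ ^ 2 + c₁ ^ 2 := lt_of_le_of_ne (by positivity) (Ne.symm hz)
      have hr := Real.sqrt_pos.mpr hpos
      have hr2 := Real.sq_sqrt hpos.le
      set r := Real.sqrt (c₀ ^ 2 + c₁ ^ 2)
      rcases le_total 0 κ with hκ | hκ
      · refine ⟨c₀ / r, c₁ / r, r, ?_, ?_, ?_, by positivity⟩ <;> field_simp
        exact hr2.symm
      · refine ⟨-c₀ / r, -c₁ / r, -r, ?_, ?_, ?_, ?_⟩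
        · field_simp
          linear_combination -hr2
        · field_simp
        · field_simp
        · nlinarith
  subst h0 h1
  obtain ⟨w₀, hw₀⟩ : ∃ w : ℝ → ℝ, w = fun t => g₀ * Real.cos (k * t) - g₁ * Real.sin (k * t) :=
    ⟨_, rfl⟩
  obtain ⟨w₁, hw₁⟩ : ∃ w : ℝ → ℝ, w = fun t => g₁ * Real.cos (k * t) + g₀ * Real.sin (k * t) :=
    ⟨_, rfl⟩
  have hw : ∀ t, w₀ t ^ 2 + w₁ t ^ 2 = 1 := by
    intro t
    simp only [hw₀, hw₁]
    linear_combination (Real.cos (k * t) ^ 2 + Real.sin (k * t) ^ 2) * hg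
      + Real.sin_sq_add_cos_sq (k * t)
  have hgw : ∀ t, g₀ * w₀ t + g₁ * w₁ t = Real.cos (k * t) := by
    intro t
    simp only [hw₀, hw₁]
    linear_combination Real.cos (k * t) * hg
  have hdcos : ∀ t, HasDerivAt (fun t => Real.cos (k * t)) (-Real.sin (k * t) * k) t := by
    intro t
    simpa using ((hasDerivAt_id' t).const_mul k).cos
  have hdsin : ∀ t, HasDerivAt (fun t => Real.sin (k * t)) (Real.cos (k * t) * k) t := by
    intro t
    simpa using ((hasDerivAt_id' t).const_mul k).sin
  have hdw₀ : ∀ t, HasDerivAt w₀ (-(k * w₁ t)) t := by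
    intro t
    rw [hw₀]
    refine (((hdcos t).const_mul g₀).fun_sub ((hdsin t).const_mul g₁)).congr_deriv ?_
    simp only [hw₁]; ring
  have hdw₁ : ∀ t, HasDerivAt w₁ (k * w₀ t) t := by
    intro t
    rw [hw₁]
    refine (((hdcos t).const_mul g₁).fun_add ((hdsin t).const_mul g₀)).congr_deriv ?_
    simp only [hw₀]; ring
  have hFe : ∀ t, F κ ((μ * g₀ + w₀ t) / k) ((μ * g₁ + w₁ t) / k)
      = 1 + κ / (4 * k ^ 2) * (μ ^ 2 + 1) + κ * μ / (2 * k ^ 2) * Real.cos (k * t) := by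
    intro t
    simp only [F]
    field_simp
    linear_combination 2 * κ * μ ^ 2 * hg + 2 * κ * hw t + 4 * κ * μ * hgw t
  set A := 1 + κ / (4 * k ^ 2) * (μ ^ 2 + 1)
  set B := κ * μ / (2 * k ^ 2) with hB
  have hB0 : 0 ≤ B := by positivity
  set J : Set ℝ := {t ∈ {t | 0 < A - B ∨ |k * t| < Real.pi} |
    0 < F κ ((μ * g₀ + w₀ t) / k) ((μ * g₁ + w₁ t) / k)} with hJ
  have himage : (fun t => ![(μ * g₀ + w₀ t) / k, (μ * g₁ + w₁ t) / k]) '' J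
      = baseCircle κ k (μ * g₀) (μ * g₁) d := by
    ext q
    constructor
    · rintro ⟨t, ht, rfl⟩
      refine ⟨ht.2, ?_⟩
      simp only [Matrix.cons_val]
      field_simp
      linear_combination hc - hw t
    · rintro ⟨hq, hqd⟩
      -- the angle of the point on the circle
      have hw1 : (k * q 0 - μ * g₀) ^ 2 + (k * q 1 - μ * g₁) ^ 2 = 1 := by
        linear_combination hc - 2 * k * hqd
      obtain ⟨θ, hθ, hcos, hsin⟩ := exists_cos_sin
        (x := g₀ * (k * q 0 - μ * g₀) + g₁ * (k * q 1 - μ * g₁))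
        (y := g₀ * (k * q 1 - μ * g₁) - g₁ * (k * q 0 - μ * g₀)) (by
          linear_combination hg * ((k * q 0 - μ * g₀) ^ 2 + (k * q 1 - μ * g₁) ^ 2) + hw1)
      have hkt : k * (θ / k) = θ := by field_simp
      have e0 : (μ * g₀ + w₀ (θ / k)) / k = q 0 := by
        simp only [hw₀, hkt, hcos, hsin]
        field_simp
        linear_combination (k * q 0 - μ * g₀) * hg
      have e1 : (μ * g₁ + w₁ (θ / k)) / k = q 1 := by
        simp only [hw₁, hkt, hcos, hsin]
        field_simp
        linear_combination (k * q 1 - μ * g₁) * hg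
      have hpos : 0 < F κ ((μ * g₀ + w₀ (θ / k)) / k) ((μ * g₁ + w₁ (θ / k)) / k) := by
        rw [e0, e1]; exact hq
      refine ⟨θ / k, ⟨?_, hpos⟩, ?_⟩
      · by_contra hcon
        simp only [Set.mem_ofPred_eq, not_or, not_lt, hkt] at hcon
        rw [hFe, hkt, ← Real.cos_abs, le_antisymm hθ hcon.2, Real.cos_pi] at hpos
        linarith [hcon.1]
      · simp only [e0, e1]
        ext i
        fin_cases i <;> rfl
  obtain ⟨t₀, ht₀⟩ : J.Nonempty := by
    rw [← himage] at hne
    exact hne.of_image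
  rw [← himage]
  refine exists_unitSpeed_reparametrization (k := k) (a := fun t => -w₁ t) (b := w₀)
    (t₀ := t₀) (fun t => ?_) (fun t => ?_) (fun t => (hdw₁ t).neg) (fun t => ?_) (fun t => ?_) ?_ ?_
    ?_ ?_ ht₀ (fun t ht => ht.2)
  · refine (((hdw₀ t).const_add (μ * g₀)).div_const k).congr_deriv ?_
    field_simp
  · refine (((hdw₁ t).const_add (μ * g₁)).div_const k).congr_deriv ?_
    field_simp
  · exact (hdw₀ t).congr_deriv (by ring)
  · linear_combination hw t
  · simp only [hw₀]; fun_prop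
  · simp only [hw₁]; fun_prop
  · have hF1 : IsOpen {t | 0 < F κ ((μ * g₀ + w₀ t) / k) ((μ * g₁ + w₁ t) / k)} :=
      isOpen_lt continuous_const (by simp only [hFe]; fun_prop)
    have hF2 : IsOpen {t : ℝ | 0 < A - B ∨ |k * t| < Real.pi} :=
      isOpen_const.union (isOpen_lt (f := fun t => |k * t|) (by fun_prop) continuous_const)
    exact hF2.inter hF1
  · rcases lt_or_ge 0 (A - B) with hAB | hAB
    · have : J = Set.univ := by
        rw [Set.eq_univ_iff_forall]
        intro t
        refine ⟨Or.inl hAB, ?_⟩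
        rw [hFe]
        nlinarith [Real.neg_one_le_cos (k * t)]
      rw [this]
      exact Set.ordConnected_univ
    · refine ordConnected_of_antitone_abs fun x hx z hz => ?_
      have hx' := hx.resolve_left (not_lt.mpr hAB)
      have hkz : |k * z| ≤ |k * x| := by rw [abs_mul, abs_mul]; gcongr
      refine ⟨Or.inr (hkz.trans_lt hx'), ?_⟩
      rw [hFe, hFe, ← Real.cos_abs (k * x), ← Real.cos_abs (k * z)]
      have := Real.cos_le_cos_of_nonneg_of_le_pi (abs_nonneg (k * z)) hx'.le hkz
      gcongr

/-- Circles and straight lines of the Euclidean plane are curves of constant geodesic curvature in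
the base. -/
theorem exists_unitSpeed_baseCircle {κ k c₀ c₁ d : ℝ} (hc : c₀ ^ 2 + c₁ ^ 2 - 2 * k * d = 1)
    (hne : (baseCircle κ k c₀ c₁ d).Nonempty) :
    ∃ (I : Set ℝ) (γ : ℝ → Fin 2 → ℝ), IsUnitSpeedCurve κ I γ ∧
      (∃ c : ℝ, ∀ s ∈ I, geodesicCurvature κ γ s = c) ∧ γ '' I = baseCircle κ k c₀ c₁ d := by
  rcases eq_or_ne k 0 with rfl | hk
  · exact exists_unitSpeed_line (by linear_combination hc) hne
  · exact exists_unitSpeed_circle hk hc hne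

end Conics

/-! ### Hopf tubes -/

section HopfTube

variable {κ τ : ℝ} {M : Type*} [TopologicalSpace M]
  [ChartedSpace (EuclideanSpace ℝ (Fin 2)) M] [IsManifold (𝓡 2) ∞ M] {φ N : M → Fin 3 → ℝ}

theorem hasStrictFDerivAt_inChart {u : M → Fin 3 → ℝ}
    (hu : ContMDiff (𝓡 2) 𝓘(ℝ, Fin 3 → ℝ) ∞ u) {p : M} {x : EuclideanSpace ℝ (Fin 2)}
    (hx : x ∈ chartDomain p) : HasStrictFDerivAt (inChart p u) (fderiv ℝ (inChart p u) x) x :=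
  ((contDiffOn_inChart hu p).contDiffAt ((isOpen_chartDomain p).mem_nhds hx)).hasStrictFDerivAt
    (by simp)

/-- The tangent plane is the orthogonal complement of the normal. -/
theorem exists_fderiv_inChart_eq (hM : IsOrientedSurface κ τ φ N) {p : M}
    {x : EuclideanSpace ℝ (Fin 2)} (hx : x ∈ chartDomain p) {b : Fin 3 → ℝ}
    (hb : inChart p (frameNormal κ τ φ N) x ⬝ᵥ frameCoord κ τ (inChart p φ x) b = 0) :
    ∃ v, fderiv ℝ (inChart p φ) x v = b := by
  obtain ⟨v, hv⟩ := exists_eq_of_dotProduct_eq_zero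
    (a := (coframe κ τ (inChart p φ) x).toLinearMap) finrank_parameterPlane
    (coframe_inChart_injective hM hx)
    (n := inChart p (frameNormal κ τ φ N) x) (frameNormal_dotProduct_self hM _)
    (normal_dotProduct_coframe hM hx) hb
  exact ⟨v, frameCoord_injective κ τ (hM.mem_space _).ne' hv⟩

/-- A surface with horizontal normal that lies over a circle or straight line of the Euclidean plane
is an open part of the Hopf tube: moving the surface in the direction of the normal at a point fills
a neighbourhood, and leaves the tube. -/
theorem exists_isOpen_range_eq (hM : IsOrientedSurface κ τ φ N)
    (hh : ∀ p, frameNormal κ τ φ N p 2 = 0) {k c₀ c₁ d : ℝ}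
    (heq : ∀ p, frameNormal κ τ φ N p 0 = c₀ - k * φ p 0 ∧
      frameNormal κ τ φ N p 1 = c₁ - k * φ p 1 ∧
      c₀ * φ p 0 + c₁ * φ p 1 - k / 2 * (φ p 0 ^ 2 + φ p 1 ^ 2) = d) :
    ∃ U : Set (Fin 3 → ℝ), IsOpen U ∧
      Set.range φ = U ∩ {q ∈ space κ | hopfFibration q ∈ baseCircle κ k c₀ c₁ d} := by
  set S : Set (Fin 3 → ℝ) := {q ∈ space κ | hopfFibration q ∈ baseCircle κ k c₀ c₁ d} with hS
  have hrange : ∀ p, φ p ∈ S := fun p =>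
    ⟨hM.mem_space p, hM.mem_space p, by simpa [hopfFibration] using (heq p).2.2⟩
  refine ⟨interior {q | q ∈ S → q ∈ Set.range φ}, isOpen_interior, Set.Subset.antisymm ?_ ?_⟩
  swap
  · rintro q ⟨hq, hqS⟩
    exact interior_subset hq hqS
  rintro _ ⟨p, rfl⟩
  refine ⟨?_, hrange p⟩
  rw [mem_interior_iff_mem_nhds]
  set x := extChartAt (𝓡 2) p p with hx
  have hxU : x ∈ chartDomain p := mem_extChartAt_target p
  have hφx : inChart p φ x = φ p := inChart_extChartAt φ (mem_extChartAt_source (I := 𝓡 2) p)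
  have hnx : inChart p (frameNormal κ τ φ N) x = frameNormal κ τ φ N p :=
    inChart_extChartAt (frameNormal κ τ φ N) (mem_extChartAt_source (I := 𝓡 2) p)
  set m : Fin 3 → ℝ := ![frameNormal κ τ φ N p 0, frameNormal κ τ φ N p 1, 0] with hm
  have hm0 : m 0 = frameNormal κ τ φ N p 0 := rfl
  have hm1' : m 1 = frameNormal κ τ φ N p 1 := rfl
  have hsum := sum_frameNormal hM p
  rw [hh p] at hsum
  -- the normal variation
  set Θ : EuclideanSpace ℝ (Fin 2) × ℝ → Fin 3 → ℝ := fun y => inChart p φ y.1 + y.2 • m with hΘ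
  have hΘd : HasStrictFDerivAt Θ (fderiv ℝ (inChart p φ) x ∘L ContinuousLinearMap.fst ℝ _ _
      + (ContinuousLinearMap.snd ℝ (EuclideanSpace ℝ (Fin 2)) ℝ).smulRight m) (x, 0) := by
    refine HasStrictFDerivAt.add ?_ ?_
    · exact (hasStrictFDerivAt_inChart hM.smooth hxU).comp (x, (0 : ℝ)) hasStrictFDerivAt_fst
    · exact hasStrictFDerivAt_snd.smul_const m
  have hΘs : (fderiv ℝ (inChart p φ) x ∘L ContinuousLinearMap.fst ℝ _ _
      + (ContinuousLinearMap.snd ℝ (EuclideanSpace ℝ (Fin 2)) ℝ).smulRight m).range = ⊤ := by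
    rw [LinearMap.range_eq_top]
    intro b
    obtain ⟨v, hv⟩ := exists_fderiv_inChart_eq hM hxU (b := b - (m 0 * b 0 + m 1 * b 1) • m) (by
      rw [hnx, hφx]
      simp only [dotProduct, Fin.sum_univ_three, frameCoord_zero, frameCoord_one, frameCoord_two,
        Pi.sub_apply, Pi.smul_apply, smul_eq_mul, hh p, hm0, hm1']
      linear_combination (-(F κ (φ p 0) (φ p 1))⁻¹ * (frameNormal κ τ φ N p 0 * b 0
        + frameNormal κ τ φ N p 1 * b 1)) * hsum)
    refine ⟨(v, m 0 * b 0 + m 1 * b 1), ?_⟩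
    simp [hv]
  have hmap := hΘd.map_nhds_eq_of_surj hΘs
  have hΘ0 : Θ (x, 0) = φ p := by simp [hΘ, hφx]
  rw [hΘ0] at hmap
  rw [← hmap, Filter.mem_map]
  have hcont : ContinuousAt (fun y : EuclideanSpace ℝ (Fin 2) × ℝ =>
      (c₀ - k * inChart p φ y.1 0) * m 0 + (c₁ - k * inChart p φ y.1 1) * m 1
        - k / 2 * y.2) (x, 0) := by
    have h1 : ContinuousAt (fun y : EuclideanSpace ℝ (Fin 2) × ℝ => inChart p φ y.1) (x, 0) :=
      ContinuousAt.comp_of_eq (g := inChart p φ) (f := Prod.fst)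
        (hasStrictFDerivAt_inChart hM.smooth hxU).hasFDerivAt.continuousAt continuousAt_fst rfl
    have h2 := fun i => (continuous_apply i).continuousAt.comp h1
    have h20 := h2 0
    have h21 := h2 1
    simp only [Function.comp_def] at h20 h21
    fun_prop
  have hne : (c₀ - k * inChart p φ x 0) * m 0 + (c₁ - k * inChart p φ x 1) * m 1
      - k / 2 * 0 ≠ 0 := by
    rw [hφx, ← (heq p).1, ← (heq p).2.1]
    simp only [hm, Matrix.cons_val]
    intro h
    nlinarith
  have hm1 : m 0 ^ 2 + m 1 ^ 2 = 1 := by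
    simp only [hm, Matrix.cons_val]; linear_combination hsum
  filter_upwards [hcont.eventually_ne hne] with y hy hyS
  refine ⟨(extChartAt (𝓡 2) p).symm y.1, ?_⟩
  have h1 := hyS.2.2
  have h2 := (heq ((extChartAt (𝓡 2) p).symm y.1)).2.2
  have h3 : φ ((extChartAt (𝓡 2) p).symm y.1) = inChart p φ y.1 := rfl
  have hm2 : m 2 = 0 := rfl
  rw [h3] at h2 ⊢
  simp only [hopfFibration, hΘ, Matrix.cons_val, Pi.add_apply, Pi.smul_apply, smul_eq_mul] at h1
  have h4 : y.2 = 0 := by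
    refine (mul_eq_zero.mp ?_).resolve_right hy
    linear_combination h1 - h2 + k / 2 * y.2 ^ 2 * hm1
  simp [hΘ, h4]

theorem exists_hopfTube_of_isCMC [ConnectedSpace M] (hκτ : κ ≠ 4 * τ ^ 2)
    (hM : IsOrientedSurface κ τ φ N) (hb : IsBiconservative κ τ φ N)
    (hmin : ¬ IsMinimal κ τ φ N) (hc : IsCMC κ τ φ N) :
    ∃ (I : Set ℝ) (γ : ℝ → Fin 2 → ℝ), IsUnitSpeedCurve κ I γ ∧
      (∃ c : ℝ, ∀ s ∈ I, geodesicCurvature κ γ s = c) ∧ IsHopfTubeOver κ φ I γ := by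
  have hh := horizontal_of_isCMC hκτ hM hb hmin hc
  obtain ⟨h, hh'⟩ := hc
  obtain ⟨k, c₀, c₁, d, heq⟩ := exists_curve_equation hM hb hh hh'
  obtain ⟨p⟩ : Nonempty M := inferInstance
  have hcd : c₀ ^ 2 + c₁ ^ 2 - 2 * k * d = 1 := by
    have hsum := sum_frameNormal hM p
    rw [hh p, (heq p).1, (heq p).2.1] at hsum
    linear_combination hsum + 2 * k * (heq p).2.2
  obtain ⟨I, γ, hγ, hcurv, himage⟩ := exists_unitSpeed_baseCircle (κ := κ) hcd
    ⟨hopfFibration (φ p), hM.mem_space p, by simpa [hopfFibration] using (heq p).2.2⟩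
  refine ⟨I, γ, hγ, hcurv, ?_⟩
  rw [IsHopfTubeOver, hopfTube, himage]
  exact exists_isOpen_range_eq hM hh heq

/-- A surface contained in a Hopf tube has horizontal normal: elsewhere it would project to the base
as an open map, but a smooth curve has empty interior. -/
theorem horizontal_of_range_subset_hopfTube (hM : IsOrientedSurface κ τ φ N) {I : Set ℝ}
    {γ : ℝ → Fin 2 → ℝ} (hγ : IsUnitSpeedCurve κ I γ) (hsub : Set.range φ ⊆ hopfTube κ I γ)
    (p : M) : frameNormal κ τ φ N p 2 = 0 := by
  by_contra hν
  set x := extChartAt (𝓡 2) p p with hx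
  have hxU : x ∈ chartDomain p := mem_extChartAt_target p
  have hφx : inChart p φ x = φ p := inChart_extChartAt φ (mem_extChartAt_source (I := 𝓡 2) p)
  have hnx : inChart p (frameNormal κ τ φ N) x = frameNormal κ τ φ N p :=
    inChart_extChartAt (frameNormal κ τ φ N) (mem_extChartAt_source (I := 𝓡 2) p)
  let π : (Fin 3 → ℝ) →L[ℝ] (Fin 2 → ℝ) :=
    ContinuousLinearMap.pi ![ContinuousLinearMap.proj 0, ContinuousLinearMap.proj 1]
  have hπ : ∀ q, π q = hopfFibration q := by
    intro q
    ext i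
    fin_cases i <;> rfl
  have hd : HasStrictFDerivAt (fun y => π (inChart p φ y)) (π ∘L fderiv ℝ (inChart p φ) x) x :=
    π.hasStrictFDerivAt.comp x (hasStrictFDerivAt_inChart hM.smooth hxU)
  have hs : (π ∘L fderiv ℝ (inChart p φ) x).range = ⊤ := by
    rw [LinearMap.range_eq_top]
    intro b
    -- the vertical component that makes the lift of `b` tangent to the surface
    obtain ⟨v, hv⟩ := exists_fderiv_inChart_eq hM hxU (b := ![b 0, b 1,
      -(τ * (F κ (φ p 0) (φ p 1))⁻¹ * (φ p 1 * b 0 - φ p 0 * b 1))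
        - (frameNormal κ τ φ N p 0 * b 0 + frameNormal κ τ φ N p 1 * b 1)
          * (F κ (φ p 0) (φ p 1))⁻¹ / frameNormal κ τ φ N p 2]) (by
      rw [hnx, hφx]
      simp [dotProduct, Fin.sum_univ_three]
      field_simp
      ring)
    refine ⟨v, ?_⟩
    simp only [ContinuousLinearMap.coe_coe, ContinuousLinearMap.comp_apply, hv, hπ]
    ext i
    fin_cases i <;> rfl
  have hmap := hd.map_nhds_eq_of_surj hs
  have hmem : γ '' I ∈ nhds (π (inChart p φ x)) := by
    rw [← hmap, Filter.mem_map]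
    refine Filter.univ_mem' fun y => ?_
    simp only [Set.mem_preimage, hπ]
    exact (hsub ⟨_, rfl⟩).2
  have hdense : Dense (γ '' I)ᶜ := by
    refine ContDiffOn.dense_compl_image_of_dimH_lt_finrank
      (hγ.smooth.of_le (by simp)) hγ.ordConnected.convex subset_rfl ?_
    refine (dimH_mono (Set.subset_univ I)).trans_lt ?_
    rw [Real.dimH_univ]
    simp
  obtain ⟨z, hz, hz'⟩ := hdense.inter_nhds_nonempty hmem
  exact hz hz'

end HopfTube

end BCV

end

theorem theorem4p4 (κ τ : ℝ) (hκτ : κ ≠ 4 * τ ^ 2)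
    {M : Type*} [TopologicalSpace M] [ConnectedSpace M]
    [ChartedSpace (EuclideanSpace ℝ (Fin 2)) M] [IsManifold (𝓡 2) ∞ M]
    (φ N : M → Fin 3 → ℝ) (hM : BCV.IsOrientedSurface κ τ φ N)
    (hbicons : BCV.IsBiconservative κ τ φ N) (hmin : ¬ BCV.IsMinimal κ τ φ N) :
    List.TFAE
      [BCV.IsConstantAngle κ τ φ N,
       BCV.IsCMC κ τ φ N,
       ∃ (I : Set ℝ) (γ : ℝ → Fin 2 → ℝ), BCV.IsUnitSpeedCurve κ I γ ∧
         (∃ c : ℝ, ∀ s ∈ I, BCV.geodesicCurvature κ γ s = c) ∧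
         BCV.IsHopfTubeOver κ φ I γ] := by
  tfae_have 1 → 2 := BCV.isCMC_of_isConstantAngle hM hbicons hmin
  tfae_have 2 → 3 := BCV.exists_hopfTube_of_isCMC hκτ hM hbicons hmin
  tfae_have 3 → 1 := by
    rintro ⟨I, γ, hγ, -, U, -, hU⟩
    refine ⟨Real.arccos 0, fun p => ?_⟩
    rw [BCV.angle_eq, BCV.horizontal_of_range_subset_hopfTube hM hγ
      (hU.trans_subset Set.inter_subset_right) p]
  tfae_finish
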